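/- **Graphs.** A graph $\Gamma$ has a set $V_\Gamma$ of vertices and a set $E_\Gamma$ of directed edges $e$ with source $s(e)$, target $t(e)$ and weight $w(e)\in\mathbb Z_{>0}$; loops and multiple edges are allowed. It is undirected if there is an involution $e\mapsto e'$ of $E_\Gamma$ with $s(e)=t(e')$, $t(e)=s(e')$, $w(e)=w(e')$. A walk is a sequence of consecutive edges (possibly empty, at a vertex), and its weight is the sum of the weights of its edges. A cycle is a non-trivial closed walk $e_1\cdots e_\ell$ with $t(e_1),\dots,t(e_\ell)$ distinct. $d_\Gamma(x,y)\in\mathbb Z_{\ge0}\cup\{\infty\}$ is the least weight of a walk from $x$ to $y$, and $\Gamma$ is strongly connected if $d_\Gamma$ is always finite. For $x_0\in V_\Gamma$ put $s_i=\#\{y: d_\Gamma(x_0,y)=i\}$, $b_i=\#\{y: d_\Gamma(x_0,y)\le i\}$, $G_s(t)=\sum_{i\ge0}s_it^i$ and $G_b(t)=\sum_{i\ge0}b_it^i$. **Periodic graphs.** Let $n\ge1$. An $n$-dimensional periodic graph $(\Gamma,L)$ is a graph $\Gamma$ with a free abelian group $L\simeq\mathbb Z^n$ acting freely on $V_\Gamma$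 and on $E_\Gamma$, with finitely many orbits on each, and preserving sources, targets and weights. Put $L_{\mathbb R}=L\otimes_{\mathbb Z}\mathbb R$. A periodic realization is a map $\Phi:V_\Gamma\to L_{\mathbb R}$ with $\Phi(u+x)=u+\Phi(x)$ for $u\in L$, $x\in V_\Gamma$. For a cycle $q$ of the quotient graph $\Gamma/L$ let $\mu(q)\in L$ be the element $t(p)-s(p)$, where $p$ is any lift of $q$ to a walk in $\Gamma$. The growth polytope is $P_\Gamma=\operatorname{conv}(\{0\}\cup\{\mu(q)/w(q): q\text{ a cycle of }\Gamma/L\})\subset L_{\mathbb R}$. $V(\cdot)$ denotes the set of vertices of a polytope. A triangulation of a $d$-dimensional polytope $\sigma$ is a finite set of $d$-simplices with union $\sigma$, such that $\Delta_1\cap\Delta_2$ is a face of $\Delta_1$ for any two members $\Delta_1,\Delta_2$. **Well-arranged.** Let $(\Gamma,L)$ be a strongly connected, undirected $n$-dimensional periodic graph, $\Phi$ a periodic realization and $x_0\in V_\Gamma$. Call integers $d_v>0$ ($v\in V(P_\Gamma)$) and triangulations $T_\sigma$ of the facets $\sigma$ of $P_\Gamma$ an arrangement for $(\Gamma,\Phi,x_0)$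 if 1. $V(\Delta)\subset V(\sigma)$ for every facet $\sigma$ and every $\Delta\in T_\sigma$; 2. $d_vv\in L$ for every $v\in V(P_\Gamma)$; 3. for every facet $\sigma$, every $\Delta\in T_\sigma$ and every $V'\subset V(\Delta)$, with $z=\bigl(\sum_{v\in V'}d_vv\bigr)+x_0$, one has $d_\Gamma(x_0,y)+d_\Gamma(y,z)=\sum_{v\in V'}d_v$ for every $y\in V_\Gamma$ with $\Phi(y)-\Phi(x_0)\in\sum_{v\in V'}[0,d_v)v$. The triple $(\Gamma,\Phi,x_0)$ is well-arranged if it has an arrangement. A quasi-polynomial is a function $f:\mathbb Z\to\mathbb C$ for which there are $N\ge1$ and $Q_0,\dots,Q_{N-1}\in\mathbb C[x]$ with $f(m)=Q_i(m)$ whenever $m\equiv i\pmod N$. **Theorem.** Let $(\Gamma,L)$ be a strongly connected, undirected $n$-dimensional periodic graph, $\Phi$ a periodic realization and $x_0\in V_\Gamma$, and suppose that $(\Gamma,\Phi,x_0)$ is well-arranged. Then: 1. The function $i\mapsto b_i$ agrees with a quasi-polynomial for all $i\ge0$. 2. For every arrangement $(d_v)$, $(T_\sigma)$ for $(\Gamma,\Phi,x_0)$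 there are polynomials $Q_1,Q_2\in\mathbb Q[t]$ such that $G_s(t)=Q_1(t)/Q_2(t)$, $\deg Q_1\le\deg Q_2$, and $Q_2$ is a least common multiple of the polynomials $\prod_{v\in V(\Delta)}(1-t^{d_v})$, where $\sigma$ runs over the facets of $P_\Gamma$ and $\Delta$ over $T_\sigma$. 3. $G_b$ and $G_s$ are expansions of rational functions, which satisfy $$G_b(1/t)=(-1)^{n+1}\,t\,G_b(t),\qquad G_s(1/t)=(-1)^nG_s(t).$$ Moreover, the sequence $s_i$ agrees with a quasi-polynomial for all $i\ge1$, and if $f_b$ and $f_s$ denote the quasi-polynomials which agree with $(b_i)$ and $(s_i)$ for all large $i$, then $f_b(-i)=(-1)^nf_b(i-1)$ for all $i\in\mathbb Z$ and $f_s(-i)=(-1)^{n+1}f_s(i)$ for all $i\in\mathbb Z\setminus\{0\}$. -/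

import Mathlib

open scoped TensorProduct Polynomial PowerSeries

noncomputable section

namespace PeriodicGrowth

/-! ### Directed weighted graphs (loops and multiple edges allowed) -/

/-- A directed graph with positive integer weights on its edges. -/
structure WGraph (V E : Type*) where
  src : E → V
  tgt : E → V
  wt : E → ℕ
  wt_pos : ∀ e, 0 < wt e

namespace WGraph

variable {V E : Type*} (Γ : WGraph V E)

/-- The sequence `p` of edges is a walk from `x` to `y`;
the empty sequence is the trivial walk at each vertex. -/
def IsWalk : V → List E → V → Prop
  | x, [], y => x = y
  | x, e :: p, y => Γ.src e = x ∧ IsWalk (Γ.tgt e) p y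

/-- The weight of a walk. -/
def weight (p : List E) : ℕ := (p.map Γ.wt).sum

/-- A cycle: a nontrivial closed walk `e₁ ⋯ e_ℓ` with `t(e₁), …, t(e_ℓ)` distinct. -/
def IsCycle (p : List E) : Prop :=
  p ≠ [] ∧ (∃ x, Γ.IsWalk x p x) ∧ (p.map Γ.tgt).Nodup

/-- The smallest weight of a walk from `x` to `y`, and `⊤` if there is no such walk. -/
def dist (x y : V) : ℕ∞ := ⨅ (p : List E) (_ : Γ.IsWalk x p y), (Γ.weight p : ℕ∞)

def StronglyConnected : Prop := ∀ x y, Γ.dist x y < ⊤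

def Undirected : Prop :=
  ∃ r : E → E, Function.Involutive r ∧
    ∀ e, Γ.src e = Γ.tgt (r e) ∧ Γ.tgt e = Γ.src (r e) ∧ Γ.wt e = Γ.wt (r e)

/-- The growth sequence `s_i`. -/
def sphereCard (x₀ : V) (i : ℕ) : ℕ := {y | Γ.dist x₀ y = i}.ncard

/-- The cumulative growth sequence `b_i`. -/
def ballCard (x₀ : V) (i : ℕ) : ℕ := {y | Γ.dist x₀ y ≤ i}.ncard

/-- `G_s(t) = ∑ s_i t^i`. -/
def sphereSeries (x₀ : V) : ℚ⟦X⟧ := PowerSeries.mk fun i => (Γ.sphereCard x₀ i : ℚ)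

/-- `G_b(t) = ∑ b_i t^i`. -/
def ballSeries (x₀ : V) : ℚ⟦X⟧ := PowerSeries.mk fun i => (Γ.ballCard x₀ i : ℚ)

end WGraph

/-! ### Periodic graphs -/

/-- A graph with a free action of `L` on vertices and edges which has finitely many orbits and
preserves sources, targets and weights. That `L` is free abelian of positive finite rank is a
hypothesis on `L`. -/
structure PeriodicGraph (L V E : Type*) [AddCommGroup L] [AddAction L V] [AddAction L E]
    extends WGraph V E where
  free_vertex : ∀ (u : L) (x : V), u +ᵥ x = x → u = 0
  free_edge : ∀ (u : L) (e : E), u +ᵥ e = e → u = 0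
  finite_vertex : Finite (AddAction.orbitRel.Quotient L V)
  finite_edge : Finite (AddAction.orbitRel.Quotient L E)
  src_vadd : ∀ (u : L) (e : E), src (u +ᵥ e) = u +ᵥ src e
  tgt_vadd : ∀ (u : L) (e : E), tgt (u +ᵥ e) = u +ᵥ tgt e
  wt_vadd : ∀ (u : L) (e : E), wt (u +ᵥ e) = wt e

/-- The real vector space `L_ℝ = L ⊗ ℝ`. -/
abbrev RealSpan (L : Type*) [AddCommGroup L] : Type _ := ℝ ⊗[ℤ] L

/-- The natural map `L → L_ℝ`, which is injective for `L` free. -/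
def toReal {L : Type*} [AddCommGroup L] (u : L) : RealSpan L := (1 : ℝ) ⊗ₜ[ℤ] u

namespace PeriodicGraph

variable {L V E : Type*} [AddCommGroup L] [AddAction L V] [AddAction L E]
  (Γ : PeriodicGraph L V E)

/-- The quotient graph `Γ / L`. -/
def quotientGraph :
    WGraph (AddAction.orbitRel.Quotient L V) (AddAction.orbitRel.Quotient L E) where
  src := Quotient.map' Γ.src (by
    rintro _ b ⟨u, rfl⟩
    exact ⟨u, (Γ.src_vadd u b).symm⟩)
  tgt := Quotient.map' Γ.tgt (by
    rintro _ b ⟨u, rfl⟩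
    exact ⟨u, (Γ.tgt_vadd u b).symm⟩)
  wt := fun e => Quotient.liftOn' e Γ.wt (by
    rintro _ b ⟨u, rfl⟩
    exact Γ.wt_vadd u b)
  wt_pos := fun e => Quotient.inductionOn' e Γ.wt_pos

/-- `μ(⟨q⟩) = u` for a closed walk `q` of `Γ / L`: some (equivalently, every) lift `p` of `q` to `Γ`
has `vec(p) = t(p) - s(p) = u`. -/
def HasVec (q : List (AddAction.orbitRel.Quotient L E)) (u : L) : Prop :=
  ∃ (p : List E) (x : V), p.map Quotient.mk'' = q ∧ Γ.IsWalk x p (u +ᵥ x)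

/-- The image of the normalization map `ν(q) = μ(⟨q⟩) / w(q)` on the cycles `q` of `Γ / L`. -/
def normalizedCycles : Set (RealSpan L) :=
  {a | ∃ q u, Γ.quotientGraph.IsCycle q ∧ Γ.HasVec q u ∧
    a = ((Γ.quotientGraph.weight q : ℝ))⁻¹ • toReal u}

/-- The growth polytope `P_Γ = conv (Im ν ∪ {0})`. -/
def growthPolytope : Set (RealSpan L) := convexHull ℝ (Γ.normalizedCycles ∪ {0})

/-- A periodic realization of the vertices in `L_ℝ`. -/
def IsRealization (_Γ : PeriodicGraph L V E) (Φ : V → RealSpan L) : Prop :=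
  ∀ (u : L) (x : V), Φ (u +ᵥ x) = toReal u + Φ x

end PeriodicGraph

/-! ### Polytopes and triangulations -/

section Polytopes

variable {W : Type*} [AddCommGroup W] [Module ℝ W]

/-- `F` is a face of the polytope `P` (both `P` and `∅` are faces). -/
def IsFace (P F : Set W) : Prop :=
  ∃ (l : W →ₗ[ℝ] ℝ) (c : ℝ), (∀ x ∈ P, l x ≤ c) ∧ F = {x ∈ P | l x = c}

/-- The dimension of (the affine hull of) a nonempty set. -/
def affDim (P : Set W) : ℕ := Module.finrank ℝ (vectorSpan ℝ P)

/-- `F` is a facet of the polytope `P`. -/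
def IsFacet (P F : Set W) : Prop := IsFace P F ∧ F.Nonempty ∧ affDim F + 1 = affDim P

/-- `T` is a triangulation of the polytope `σ`; a simplex is given by its set of vertices. -/
structure IsTriangulation (σ : Set W) (T : Finset (Finset W)) : Prop where
  card_eq : ∀ Δ ∈ T, Δ.card = affDim σ + 1
  indep : ∀ Δ ∈ T, AffineIndependent ℝ (fun v : Δ => (v : W))
  union_eq : σ = ⋃ Δ ∈ T, convexHull ℝ (Δ : Set W)
  inter_face : ∀ Δ₁ ∈ T, ∀ Δ₂ ∈ T,
    IsFace (convexHull ℝ (Δ₁ : Set W)) (convexHull ℝ (Δ₁ : Set W) ∩ convexHull ℝ (Δ₂ : Set W))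

end Polytopes

/-! ### Well-arranged triples -/

section WellArranged

variable {L V E : Type*} [AddCommGroup L] [AddAction L V] [AddAction L E]

/-- The integers `d_v` (`v` a vertex of `P_Γ`) and the triangulations `T_σ` (`σ` a facet of `P_Γ`)
witness that `(Γ, Φ, x₀)` is well-arranged. The values of `d` and `T` elsewhere are irrelevant. -/
structure IsArrangement (Γ : PeriodicGraph L V E) (Φ : V → RealSpan L) (x₀ : V)
    (d : RealSpan L → ℕ) (T : Set (RealSpan L) → Finset (Finset (RealSpan L))) : Prop where
  pos : ∀ v ∈ Γ.growthPolytope.extremePoints ℝ, 0 < d v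
  triangulation : ∀ σ, IsFacet Γ.growthPolytope σ → IsTriangulation σ (T σ)
  vertices : ∀ σ, IsFacet Γ.growthPolytope σ → ∀ Δ ∈ T σ,
    (Δ : Set (RealSpan L)) ⊆ σ.extremePoints ℝ
  integral : ∀ v ∈ Γ.growthPolytope.extremePoints ℝ, ∃ u : L, toReal u = (d v : ℝ) • v
  dist_add : ∀ σ, IsFacet Γ.growthPolytope σ → ∀ Δ ∈ T σ, ∀ V' ⊆ Δ,
    ∀ u : L, toReal u = ∑ v ∈ V', (d v : ℝ) • v →
    ∀ y : V, (∃ c : RealSpan L → ℝ, (∀ v ∈ V', 0 ≤ c v ∧ c v < d v) ∧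
        Φ y - Φ x₀ = ∑ v ∈ V', c v • v) →
      Γ.dist x₀ y + Γ.dist y (u +ᵥ x₀) = ((∑ v ∈ V', d v : ℕ) : ℕ∞)

/-- `(Γ, Φ, x₀)` is well-arranged. -/
def WellArranged (Γ : PeriodicGraph L V E) (Φ : V → RealSpan L) (x₀ : V) : Prop :=
  ∃ d T, IsArrangement Γ Φ x₀ d T

/-- The polynomials `∏_{v ∈ V(Δ)} (1 - t^{d_v})`, for the simplices `Δ` of the triangulations
`T_σ` of the facets `σ` of `P_Γ`. -/
def simplexPolynomials (Γ : PeriodicGraph L V E)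
    (d : RealSpan L → ℕ) (T : Set (RealSpan L) → Finset (Finset (RealSpan L))) : Set ℚ[X] :=
  {f | ∃ σ, IsFacet Γ.growthPolytope σ ∧ ∃ Δ ∈ T σ,
    f = ∏ v ∈ Δ, (1 - (Polynomial.X : ℚ[X]) ^ d v)}

end WellArranged

/-! ### Quasi-polynomials and rational functions -/

def IsQuasiPolynomial (f : ℤ → ℂ) : Prop :=
  ∃ N : ℕ, 0 < N ∧ ∃ Q : Fin N → ℂ[X],
    ∀ (i : Fin N) (m : ℤ), m ≡ (i : ℤ) [ZMOD N] → f m = (Q i).eval (m : ℂ)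

/-- `g` is a quasi-polynomial on `i ≥ m`. -/
def IsQuasiPolynomialOn (g : ℕ → ℕ) (m : ℕ) : Prop :=
  ∃ f, IsQuasiPolynomial f ∧ ∀ i : ℕ, m ≤ i → (g i : ℂ) = f i

/-- `f` is the quasi-polynomial corresponding to the sequence `g`: they agree at all large `i`. -/
def IsQuasiPolynomialOf (f : ℤ → ℂ) (g : ℕ → ℕ) : Prop :=
  IsQuasiPolynomial f ∧ ∃ M : ℕ, ∀ i : ℕ, M < i → (g i : ℂ) = f i

/-- `Q` is a least common multiple of the polynomials in `S` (unique up to a nonzero constant). -/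
def IsLCM (S : Set ℚ[X]) (Q : ℚ[X]) : Prop :=
  (∀ f ∈ S, f ∣ Q) ∧ ∀ R : ℚ[X], (∀ f ∈ S, f ∣ R) → Q ∣ R

/-- The power series `G` is the expansion at `0` of the rational function `R`. -/
def IsExpansion (R : RatFunc ℚ) (G : ℚ⟦X⟧) : Prop :=
  (R : LaurentSeries ℚ) = (G : LaurentSeries ℚ)

/-- The rational function `R(1/t)`. -/
def atInv (R : RatFunc ℚ) : RatFunc ℚ := R.eval RatFunc.C (RatFunc.X)⁻¹

end PeriodicGrowth

end

open PeriodicGrowth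

/-! The cones over the simplices of the triangulated facets form a complete simplicial fan in `L_ℝ`.
In one cone, with vertices `v` and lattice generators `w_v = d_v v`, distances are explicit. The
facet normal `l` is at most 1 on all normalized cycles and equals 1 on the simplex; since closed
walks modulo `L` decompose into cycles, moving by `∑ k_v w_v` costs at least `∑ k_v d_v`. The box
condition of an arrangement gives the matching upper bound and puts every vertex of the cone on a
geodesic (`IsGeodesicCone.geodesic`). Hence adding `w_v` inside the cone raises the distance from
`x₀` by exactly `d_v`, and the vertices of a half-open cone have generating function `N_Δ(t) / ∏ (1
- t^{d_v})`, where `N_Δ` counts a half-open fundamental box (`prod_mul_genFun`).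

As the graph is undirected, `y ↦ y - ∑ w_v` carries this box to the box of the opposite cone and
replaces the distance `m` by `∑ d_v - m` (`dist_box`). The opposite half-open cone, with
complementary walls, therefore has the reflected numerator over the same denominator
(`exists_numerator`).

A generic direction `ξ` decides which walls belong to which cone, so that the half-open cones
partition the vertices (`existsUnique_halfOpen`); applied to `-ξ` and `-p`, the same statement shows
that the opposite cones partition them too. Thus `G_s` has two decompositions whose numerators are
reflections of each other (`IsReciprocal`). Substituting `1/t` turns one into `(-1)^n` times the
other, which is the reciprocity law, without inclusion-exclusion over lower-dimensional cones. The
bound `deg N_Δ ≤ ∑ d_v` gives the degree bound over the least common multiple.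

Finally `G_b = G_s / (1 - t) = A / (1 - t^K)^{n+1}` with `deg A < K(n+1)`, which makes `b_i` a
quasi-polynomial from `i = 0` on. Reciprocity makes `A` palindromic, and this symmetry gives
`f_b(-i) = (-1)^n f_b(i-1)`. -/

noncomputable section

namespace PeriodicGrowth

/-! ### Walks and distances -/

namespace WGraph

variable {V E : Type*} (Γ : WGraph V E)

theorem isWalk_append {p q : List E} {x z : V} :
    Γ.IsWalk x (p ++ q) z ↔ ∃ y, Γ.IsWalk x p y ∧ Γ.IsWalk y q z := by
  induction p generalizing x with
  | nil => simp [IsWalk]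
  | cons e p ih => simp [IsWalk, ih, and_assoc]

theorem weight_append (p q : List E) : Γ.weight (p ++ q) = Γ.weight p + Γ.weight q := by
  simp [weight]

theorem length_le_weight (p : List E) : p.length ≤ Γ.weight p := by
  induction p with
  | nil => simp
  | cons e p ih =>
    have := Γ.wt_pos e
    simp only [weight, List.map_cons, List.sum_cons, List.length_cons] at ih ⊢
    omega

/-- The distance as a natural number, which is meaningful if there is a walk. -/
def natDist (x y : V) : ℕ := sInf {m | ∃ p, Γ.IsWalk x p y ∧ Γ.weight p = m}

variable {Γ}

theorem StronglyConnected.exists_isWalk (h : Γ.StronglyConnected) (x y : V) :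
    ∃ p, Γ.IsWalk x p y := by
  by_contra! hp
  have := h x y
  simp [dist, hp] at this

theorem StronglyConnected.exists_weight_eq (h : Γ.StronglyConnected) (x y : V) :
    ∃ p, Γ.IsWalk x p y ∧ Γ.weight p = Γ.natDist x y := by
  obtain ⟨p, hp⟩ := h.exists_isWalk x y
  exact Nat.sInf_mem (s := {m | ∃ p, Γ.IsWalk x p y ∧ Γ.weight p = m}) ⟨_, p, hp, rfl⟩

theorem natDist_le_weight {x y : V} {p : List E} (hp : Γ.IsWalk x p y) :
    Γ.natDist x y ≤ Γ.weight p :=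
  Nat.sInf_le ⟨p, hp, rfl⟩

theorem StronglyConnected.dist_eq (h : Γ.StronglyConnected) (x y : V) :
    Γ.dist x y = (Γ.natDist x y : ℕ∞) := by
  apply le_antisymm
  · obtain ⟨p, hp, hw⟩ := h.exists_weight_eq x y
    rw [← hw]
    exact iInf₂_le p hp
  · refine le_iInf₂ fun p hp => ?_
    exact_mod_cast natDist_le_weight hp

theorem natDist_self (x : V) : Γ.natDist x x = 0 := by
  have := natDist_le_weight (Γ := Γ) (x := x) (y := x) (p := []) rfl
  simpa [weight] using this

theorem StronglyConnected.natDist_triangle (h : Γ.StronglyConnected) (x y z : V) :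
    Γ.natDist x z ≤ Γ.natDist x y + Γ.natDist y z := by
  obtain ⟨p, hp, hpw⟩ := h.exists_weight_eq x y
  obtain ⟨q, hq, hqw⟩ := h.exists_weight_eq y z
  rw [← hpw, ← hqw, ← weight_append]
  exact natDist_le_weight ((Γ.isWalk_append).2 ⟨y, hp, hq⟩)

theorem IsWalk.reverse {r : E → E} (hr : ∀ e, Γ.src e = Γ.tgt (r e) ∧ Γ.tgt e = Γ.src (r e))
    {x y : V} {p : List E} (hp : Γ.IsWalk x p y) : Γ.IsWalk y (p.map r).reverse x := by
  induction p generalizing x with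
  | nil => exact hp.symm
  | cons e p ih =>
    rw [List.map_cons, List.reverse_cons, isWalk_append]
    exact ⟨_, ih hp.2, (hr e).2.symm, by rw [← (hr e).1]; exact hp.1⟩

theorem StronglyConnected.natDist_comm (h : Γ.StronglyConnected) (hu : Γ.Undirected) (x y : V) :
    Γ.natDist x y = Γ.natDist y x := by
  obtain ⟨r, -, hr⟩ := hu
  have key : ∀ x y, Γ.natDist y x ≤ Γ.natDist x y := by
    intro x y
    obtain ⟨p, hp, hpw⟩ := h.exists_weight_eq x y
    rw [← hpw]
    refine (natDist_le_weight (hp.reverse fun e => ⟨(hr e).1, (hr e).2.1⟩)).trans (le_of_eq ?_)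
    have : ∀ e, Γ.wt (r e) = Γ.wt e := fun e => (hr e).2.2.symm
    simp [weight, Function.comp_def, this]
  exact le_antisymm (key _ _) (key _ _)

theorem finite_isWalk_length (hfin : ∀ x, {e | Γ.src e = x}.Finite) (k : ℕ) (x : V) :
    {y | ∃ p : List E, p.length = k ∧ Γ.IsWalk x p y}.Finite := by
  induction k generalizing x with
  | zero =>
    refine (Set.finite_singleton x).subset ?_
    rintro y ⟨p, hp, hw⟩
    rw [List.length_eq_zero_iff] at hp
    subst hp
    exact hw.symm
  | succ k ih =>
    refine ((hfin x).biUnion fun e _ => ih (Γ.tgt e)).subset ?_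
    rintro y ⟨p, hp, hw⟩
    cases p with
    | nil => simp at hp
    | cons e p =>
      simp only [List.length_cons, Nat.add_right_cancel_iff] at hp
      exact Set.mem_biUnion (show e ∈ {e | Γ.src e = x} from hw.1) ⟨p, hp, hw.2⟩

theorem StronglyConnected.finite_ball (h : Γ.StronglyConnected)
    (hfin : ∀ x, {e | Γ.src e = x}.Finite) (x : V) (i : ℕ) : {y | Γ.natDist x y ≤ i}.Finite := by
  refine ((Set.finite_Iic i).biUnion fun k _ => finite_isWalk_length hfin k x).subset ?_
  intro y hy
  obtain ⟨p, hp, hw⟩ := h.exists_weight_eq x y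
  exact Set.mem_biUnion (show p.length ∈ Set.Iic i from
    (Γ.length_le_weight p).trans (hw.trans_le hy)) ⟨p, rfl, hp⟩

end WGraph

/-- Locates the two visits to one vertex orbit at which a closed walk of the quotient is cut. -/
theorem _root_.List.exists_split_of_not_nodup_map {α β : Type*} (f : α → β) (p : List α)
    (h : ¬ (p.map f).Nodup) :
    ∃ p₁ e p₂ e' p₃, p = p₁ ++ e :: (p₂ ++ e' :: p₃) ∧ f e = f e' := by
  induction p with
  | nil => simp at h
  | cons a p ih =>
    by_cases hp : (p.map f).Nodup
    · have : f a ∈ p.map f := by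
        by_contra ha
        exact h (by simpa using ⟨by simpa using ha, hp⟩)
      obtain ⟨b, hb, hab⟩ := List.mem_map.1 this
      obtain ⟨s, t, rfl⟩ := List.append_of_mem hb
      exact ⟨[], a, s, b, t, rfl, hab.symm⟩
    · obtain ⟨p₁, e, p₂, e', p₃, rfl, hee⟩ := ih hp
      exact ⟨a :: p₁, e, p₂, e', p₃, rfl, hee⟩

/-- `p` is a nonnegative combination of the elements of `S`. -/
def InCone {W : Type*} [AddCommGroup W] [Module ℝ W] (S : Finset W) (p : W) : Prop :=
  ∃ a : W → ℝ, (∀ s, 0 ≤ a s) ∧ ∑ s ∈ S, a s • s = p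

namespace InCone

variable {W : Type*} [AddCommGroup W] [Module ℝ W] {S : Finset W}

theorem zero : InCone S 0 := ⟨0, fun _ => le_rfl, by simp⟩

theorem add {p q : W} (hp : InCone S p) (hq : InCone S q) : InCone S (p + q) := by
  obtain ⟨a, ha, rfl⟩ := hp
  obtain ⟨b, hb, rfl⟩ := hq
  exact ⟨a + b, fun s => add_nonneg (ha s) (hb s), by simp [add_smul, Finset.sum_add_distrib]⟩

theorem smul {p : W} (hp : InCone S p) {r : ℝ} (hr : 0 ≤ r) : InCone S (r • p) := by
  obtain ⟨a, ha, rfl⟩ := hp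
  exact ⟨r • a, fun s => mul_nonneg hr (ha s), by simp [mul_smul, Finset.smul_sum]⟩

theorem of_mem {p : W} (hp : p ∈ S) : InCone S p := by
  classical
  exact ⟨fun s => if s = p then 1 else 0, fun s => by dsimp only; split_ifs <;> norm_num,
    by simp [ite_smul, hp]⟩

end InCone

/-- The natural map `L → L_ℝ` as an additive map. -/
def toRealHom (L : Type*) [AddCommGroup L] : L →+ RealSpan L where
  toFun := toReal
  map_zero' := TensorProduct.tmul_zero _ _
  map_add' := TensorProduct.tmul_add _

@[simp] theorem toRealHom_apply {L : Type*} [AddCommGroup L] (u : L) :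
    toRealHom L u = toReal u := rfl

theorem toReal_add {L : Type*} [AddCommGroup L] (u v : L) :
    toReal (u + v) = toReal u + toReal v := map_add (toRealHom L) u v

theorem toReal_zero {L : Type*} [AddCommGroup L] : toReal (0 : L) = 0 := map_zero (toRealHom L)

theorem toReal_nsmul {L : Type*} [AddCommGroup L] (k : ℕ) (u : L) :
    toReal (k • u) = (k : ℝ) • toReal u := by
  rw [← toRealHom_apply, map_nsmul, toRealHom_apply, Nat.cast_smul_eq_nsmul]

theorem toReal_sum {L ι : Type*} [AddCommGroup L] (s : Finset ι) (u : ι → L) :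
    toReal (∑ i ∈ s, u i) = ∑ i ∈ s, toReal (u i) := map_sum (toRealHom L) u s

/-! ### Translations, closed walks modulo `L`, and normalized cycles. -/

namespace PeriodicGraph

variable {L V E : Type*} [AddCommGroup L] [AddAction L V] [AddAction L E]
  {Γ : PeriodicGraph L V E}

theorem vadd_injective (Γ : PeriodicGraph L V E) {u v : L} {x : V} (h : u +ᵥ x = v +ᵥ x) :
    u = v := by
  have h2 : (-v + u) +ᵥ x = x := by rw [add_vadd, h, neg_vadd_vadd]
  have := Γ.free_vertex _ _ h2
  exact (neg_add_eq_zero.1 this).symm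

theorem IsWalk.vadd {p : List E} {x y : V} (h : Γ.IsWalk x p y) (u : L) :
    Γ.IsWalk (u +ᵥ x) (p.map (u +ᵥ ·)) (u +ᵥ y) := by
  induction p generalizing x with
  | nil => exact congrArg (u +ᵥ ·) h
  | cons e p ih =>
    refine ⟨?_, ?_⟩
    · rw [Γ.src_vadd, h.1]
    · rw [Γ.tgt_vadd]
      exact ih h.2

theorem weight_vadd (p : List E) (u : L) : Γ.weight (p.map (u +ᵥ ·)) = Γ.weight p := by
  simp [WGraph.weight, Function.comp_def, Γ.wt_vadd]

theorem natDist_vadd (hconn : Γ.StronglyConnected) (u : L) (x y : V) :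
    Γ.natDist (u +ᵥ x) (u +ᵥ y) = Γ.natDist x y := by
  have key : ∀ (u : L) x y, Γ.natDist (u +ᵥ x) (u +ᵥ y) ≤ Γ.natDist x y := by
    intro u x y
    obtain ⟨p, hp, hw⟩ := hconn.exists_weight_eq x y
    rw [← hw, ← weight_vadd p u]
    exact WGraph.natDist_le_weight (IsWalk.vadd hp u)
  refine le_antisymm (key _ _ _) ?_
  simpa using key (-u) (u +ᵥ x) (u +ᵥ y)

/-- A translation between two edges with the same source fixes that source, hence is trivial; so the
edges at a vertex inject into the finite set of edge orbits. -/
theorem finite_src (Γ : PeriodicGraph L V E) (x : V) : {e | Γ.src e = x}.Finite := by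
  have := Γ.finite_edge
  refine Set.Finite.of_finite_image (f := fun e => (Quotient.mk'' e :
    AddAction.orbitRel.Quotient L E)) (Set.toFinite _) ?_
  intro e he e' he' h
  obtain ⟨u, rfl⟩ := (Quotient.eq''.1 h : (AddAction.orbitRel L E) e e')
  simp only [Set.mem_ofPred_eq] at he he'
  have hu : u +ᵥ Γ.src e' = Γ.src e' := by
    rw [← Γ.src_vadd, he']; exact he
  show u +ᵥ e' = e'
  rw [Γ.free_vertex _ _ hu, zero_vadd]

theorem finite_ball (hconn : Γ.StronglyConnected) (x : V) (i : ℕ) :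
    {y | Γ.natDist x y ≤ i}.Finite :=
  hconn.finite_ball Γ.finite_src x i

theorem quotientGraph_isWalk {p : List E} {x y : V} (h : Γ.IsWalk x p y) :
    Γ.quotientGraph.IsWalk (Quotient.mk'' x) (p.map Quotient.mk'') (Quotient.mk'' y) := by
  induction p generalizing x with
  | nil => exact congrArg _ h
  | cons e p ih => exact ⟨congrArg Quotient.mk'' h.1, ih h.2⟩

theorem quotientGraph_weight (p : List E) :
    Γ.quotientGraph.weight (p.map Quotient.mk'') = Γ.weight p := by
  simp only [WGraph.weight, List.map_map]
  rfl

/-- A closed walk of the quotient decomposes into cycles. -/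
theorem closed_walk_induction {C : L → ℕ → Prop} (hzero : C 0 0)
    (hadd : ∀ u v a b, C u a → C v b → C (u + v) (a + b))
    (hcycle : ∀ q u, Γ.quotientGraph.IsCycle q → Γ.HasVec q u → C u (Γ.quotientGraph.weight q))
    {p : List E} {x : V} {u : L} (hp : Γ.IsWalk x p (u +ᵥ x)) : C u (Γ.weight p) := by
  induction hk : p.length using Nat.strong_induction_on generalizing p x u with
  | _ k ih =>
  subst hk
  by_cases hnil : p = []
  · subst hnil
    have : u = 0 := Γ.free_vertex _ _ (Eq.symm hp)
    subst this
    exact hzero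
  by_cases hnd : (p.map fun e => (Quotient.mk'' (Γ.tgt e) :
      AddAction.orbitRel.Quotient L V)).Nodup
  · rw [← quotientGraph_weight]
    refine hcycle _ u ⟨by simpa using hnil, ⟨Quotient.mk'' x, ?_⟩, ?_⟩ ⟨p, x, rfl, hp⟩
    · have := quotientGraph_isWalk hp
      have hq : (Quotient.mk'' (u +ᵥ x) : AddAction.orbitRel.Quotient L V) = Quotient.mk'' x :=
        Quotient.eq''.2 ⟨u, rfl⟩
      rwa [hq] at this
    · rw [List.map_map]
      exact hnd
  -- The segment between two visits to the same orbit is closed modulo `L`, with vector `g`. Cutting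
  -- it out and translating the tail by `-g` leaves a shorter closed walk with vector `-g + u`.
  · obtain ⟨p₁, e, p₂, e', p₃, rfl, hee⟩ := List.exists_split_of_not_nodup_map _ _ hnd
    obtain ⟨g, hg⟩ := (Quotient.eq''.1 hee.symm : (AddAction.orbitRel L V) _ _)
    simp only at hg
    rw [show p₁ ++ e :: (p₂ ++ e' :: p₃) = (p₁ ++ [e]) ++ ((p₂ ++ [e']) ++ p₃) by simp] at hp ih ⊢
    obtain ⟨y₁, h₁, h₂⟩ := (Γ.isWalk_append).1 hp
    obtain ⟨y₂, h₂, h₃⟩ := (Γ.isWalk_append).1 h₂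
    have hy₁ : y₁ = Γ.tgt e := by
      obtain ⟨_, _, h⟩ := (Γ.isWalk_append).1 h₁
      exact h.2.symm
    have hy₂ : y₂ = g +ᵥ y₁ := by
      obtain ⟨_, _, h⟩ := (Γ.isWalk_append).1 h₂
      rw [hy₁]
      exact h.2.symm.trans hg.symm
    subst hy₂
    have hin := ih _ (by simp; omega) h₂ rfl
    have h₃' := IsWalk.vadd h₃ (-g)
    rw [neg_vadd_vadd, ← add_vadd] at h₃'
    have hout := ih _ (by simp) ((Γ.isWalk_append).2 ⟨_, h₁, h₃'⟩) rfl
    have := hadd _ _ _ _ hin hout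
    rw [add_neg_cancel_left] at this
    convert this using 1
    simp only [WGraph.weight_append, weight_vadd]
    omega

/-- The bound holds on cycles by the choice of `l`, and both sides add up when a closed walk is
decomposed. All lower bounds on distances come from here. -/
theorem map_toReal_le_weight (l : RealSpan L →ₗ[ℝ] ℝ) (hl : ∀ a ∈ Γ.normalizedCycles, l a ≤ 1)
    {p : List E} {x : V} {u : L} (hp : Γ.IsWalk x p (u +ᵥ x)) : l (toReal u) ≤ Γ.weight p := by
  refine closed_walk_induction (Γ := Γ) (C := fun u a => l (toReal u) ≤ a) ?_ ?_ ?_ hp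
  · simp [toReal_zero]
  · intro u v a b h₁ h₂
    rw [toReal_add, map_add]
    push_cast
    exact add_le_add h₁ h₂
  · intro q u hq hu
    have h := hl _ ⟨q, u, hq, hu, rfl⟩
    have hpos : 0 < (Γ.quotientGraph.weight q : ℝ) := by
      have h1 := Γ.quotientGraph.length_le_weight q
      have h2 := List.length_pos_iff.2 hq.1
      exact_mod_cast h2.trans_le h1
    rw [map_smul, smul_eq_mul, inv_mul_le_iff₀ hpos, mul_one] at h
    exact h

theorem map_toReal_le_natDist (hconn : Γ.StronglyConnected) (l : RealSpan L →ₗ[ℝ] ℝ)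
    (hl : ∀ a ∈ Γ.normalizedCycles, l a ≤ 1) (x : V) (u : L) :
    l (toReal u) ≤ Γ.natDist x (u +ᵥ x) := by
  obtain ⟨p, hp, hw⟩ := hconn.exists_weight_eq x (u +ᵥ x)
  rw [← hw]
  exact map_toReal_le_weight l hl hp

theorem hasVec_unique {q : List (AddAction.orbitRel.Quotient L E)} {u v : L} (hq : q ≠ [])
    (hu : Γ.HasVec q u) (hv : Γ.HasVec q v) : u = v := by
  obtain ⟨p, x, hp, hw⟩ := hu
  obtain ⟨p', x', hp', hw'⟩ := hv
  -- Two lifts of a nonempty walk differ by one translation, because the action on edges is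
  -- transitive on each orbit. Lifts of the empty walk may start at unrelated vertices.
  have key : ∀ (p p' : List E) (x y x' y' : V), p ≠ [] →
      p.map (Quotient.mk'' : E → AddAction.orbitRel.Quotient L E) = p'.map Quotient.mk'' →
      Γ.IsWalk x p y → Γ.IsWalk x' p' y' → ∃ g : L, x' = g +ᵥ x ∧ y' = g +ᵥ y := by
    intro p
    induction p with
    | nil => intro _ _ _ _ _ h; exact absurd rfl h
    | cons e p ih =>
      intro p' x y x' y' _ heq hw hw'
      cases p' with
      | nil => simp at heq
      | cons e' p' =>
        simp only [List.map_cons, List.cons.injEq] at heq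
        obtain ⟨g, hg⟩ := (Quotient.eq''.1 heq.1.symm : (AddAction.orbitRel L E) e' e)
        simp only at hg
        have hx : x' = g +ᵥ x := by
          rw [← hw.1, ← hw'.1, ← hg, Γ.src_vadd]
        refine ⟨g, hx, ?_⟩
        have ht : Γ.tgt e' = g +ᵥ Γ.tgt e := by rw [← hg, Γ.tgt_vadd]
        by_cases hp : p = []
        · subst hp
          have : p' = [] := by simpa using heq.2.symm
          subst this
          have h1 : Γ.tgt e = y := hw.2
          have h2 : Γ.tgt e' = y' := hw'.2
          rw [← h1, ← h2, ht]
        · obtain ⟨g', h1, h2⟩ := ih p' _ _ _ _ hp heq.2 hw.2 hw'.2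
          rw [h2]
          rw [ht] at h1
          rw [Γ.vadd_injective h1]
  obtain ⟨g, h1, h2⟩ := key p p' x _ x' _ (by rintro rfl; simp at hp; exact hq hp)
    (hp.trans hp'.symm) hw hw'
  rw [h1, ← add_vadd, ← add_vadd] at h2
  have := Γ.vadd_injective h2
  rw [add_comm g u] at this
  exact (add_right_cancel this).symm

/-- Distinct targets bound the length of a cycle by the number of vertex orbits, and each cycle
contributes a single point by `hasVec_unique`. -/
theorem finite_normalizedCycles (Γ : PeriodicGraph L V E) : Γ.normalizedCycles.Finite := by
  classical
  have := Γ.finite_vertex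
  have := Γ.finite_edge
  have := Fintype.ofFinite (AddAction.orbitRel.Quotient L V)
  have hfin : {q : List (AddAction.orbitRel.Quotient L E) | Γ.quotientGraph.IsCycle q}.Finite := by
    refine (List.finite_length_le (AddAction.orbitRel.Quotient L E)
      (Fintype.card (AddAction.orbitRel.Quotient L V))).subset ?_
    intro q hq
    simpa using hq.2.2.length_le_card
  refine (hfin.biUnion (t := fun q => {a | ∃ u, Γ.quotientGraph.IsCycle q ∧ Γ.HasVec q u ∧
    a = ((Γ.quotientGraph.weight q : ℝ))⁻¹ • toReal u}) ?_).subset ?_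
  · intro q hq
    refine Set.Subsingleton.finite ?_
    rintro _ ⟨u, -, hu, rfl⟩ _ ⟨v, -, hv, rfl⟩
    rw [hasVec_unique hq.1 hu hv]
  · rintro a ⟨q, u, hq, hu, rfl⟩
    exact Set.mem_biUnion (show q ∈ {q | _} from hq) ⟨u, hq, hu, rfl⟩

/-- Every vector is a nonnegative combination of the normalized cycles. -/
theorem inCone_normalizedCycles (hconn : Γ.StronglyConnected) (x₀ : V)
    {S : Finset (RealSpan L)} (hS : Γ.normalizedCycles ⊆ S) (p : RealSpan L) : InCone S p := by
  have hu : ∀ u : L, InCone S (toReal u) := by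
    intro u
    obtain ⟨p, hp⟩ := hconn.exists_isWalk x₀ (u +ᵥ x₀)
    refine closed_walk_induction (Γ := Γ) (C := fun u _ => InCone S (toReal u)) ?_ ?_ ?_ hp
    · rw [toReal_zero]; exact InCone.zero
    · intro u v _ _ h₁ h₂
      rw [toReal_add]; exact h₁.add h₂
    · intro q u hq hu
      have hpos : (Γ.quotientGraph.weight q : ℝ) ≠ 0 := by
        have h1 := Γ.quotientGraph.length_le_weight q
        have h2 := List.length_pos_iff.2 hq.1
        exact_mod_cast (h2.trans_le h1).ne'
      have := (InCone.of_mem (hS ⟨q, u, hq, hu, rfl⟩)).smul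
        (Nat.cast_nonneg (α := ℝ) (Γ.quotientGraph.weight q))
      rwa [smul_inv_smul₀ hpos] at this
  -- All lattice vectors are already in the cone, so a negative scalar can be absorbed by replacing
  -- `u` with `-u`.
  induction p using TensorProduct.induction_on with
  | zero => exact InCone.zero
  | add a b ha hb => exact ha.add hb
  | tmul r u =>
    rcases le_total 0 r with hr | hr
    · have := (hu u).smul hr
      rwa [toReal, TensorProduct.smul_tmul', smul_eq_mul, mul_one] at this
    · have := (hu (-u)).smul (neg_nonneg.2 hr)
      rwa [toReal, TensorProduct.smul_tmul', smul_eq_mul,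
        mul_one, TensorProduct.neg_tmul, TensorProduct.tmul_neg, neg_neg] at this

end PeriodicGraph

/-! ### Facets of a polytope and the cones over the simplices of their triangulations -/

section Cones

open Module

variable {W : Type*} [AddCommGroup W] [Module ℝ W] [FiniteDimensional ℝ W]

/-- A representation as a nonnegative combination with the least sum of coefficients. -/
theorem exists_minimal_coeff (S : Finset W) {p : W} (hp : InCone S p) :
    ∃ a : S → ℝ, 0 ≤ a ∧ ∑ s, a s • (s : W) = p ∧
      ∀ b : S → ℝ, 0 ≤ b → ∑ s, b s • (s : W) = p → ∑ s, a s ≤ ∑ s, b s := by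
  obtain ⟨a₀, ha₀, hp⟩ := hp
  set φ : (S → ℝ) →ₗ[ℝ] W := Fintype.linearCombination ℝ (fun s : S => (s : W)) with hφ
  have hφa : ∀ a : S → ℝ, φ a = ∑ s, a s • (s : W) := fun a => by
    simp [hφ, Fintype.linearCombination_apply]
  let e := (finBasis ℝ W).equivFun
  have hcont : Continuous (e.toLinearMap ∘ₗ φ) := LinearMap.continuous_of_finiteDimensional _
  have hcl : IsClosed {a : S → ℝ | φ a = p} := by
    have : {a : S → ℝ | φ a = p} = (e.toLinearMap ∘ₗ φ) ⁻¹' {e p} := by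
      ext a
      simp
    rw [this]
    exact isClosed_singleton.preimage hcont
  -- Only representations with coefficient sum at most that of `a₀` compete for the minimum, and
  -- these lie in the compact cube `[0, C]^S`.
  set C := ∑ s : S, a₀ s with hC
  have hsum : Continuous fun a : S → ℝ => ∑ s, a s :=
    continuous_finsetSum _ fun s _ => continuous_apply s
  have hK : IsCompact (Set.Icc (0 : S → ℝ) (fun _ => C) ∩ {a | φ a = p}) :=
    isCompact_Icc.inter_right hcl
  have hmem : ∀ b : S → ℝ, 0 ≤ b → φ b = p → ∑ s, b s ≤ C →
      b ∈ Set.Icc (0 : S → ℝ) (fun _ => C) ∩ {a | φ a = p} := by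
    intro b hb hbp hbC
    refine ⟨⟨hb, fun s => ?_⟩, hbp⟩
    exact (Finset.single_le_sum (f := b) (fun i _ => hb i) (Finset.mem_univ s)).trans hbC
  have ha₀p : φ (fun s => a₀ s) = p := by
    rw [hφa, ← hp, ← Finset.sum_coe_sort S (fun s => a₀ s • s)]
  have hne := hmem (fun s => a₀ s) (fun s => ha₀ s) ha₀p le_rfl
  obtain ⟨a, ha, hmin⟩ := hK.exists_isMinOn ⟨_, hne⟩ hsum.continuousOn
  refine ⟨a, ha.1.1, by rw [← hφa]; exact ha.2, fun b hb hbp => ?_⟩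
  rw [← hφa] at hbp
  by_cases hbC : ∑ s, b s ≤ C
  · exact hmin (hmem b hb hbp hbC)
  · exact (hmin hne).trans (le_of_not_ge hbC)

/-- Every nonzero vector lies in the cone over a face of `conv S` which is cut out by `l = 1`. -/
theorem exists_supporting (S : Finset W) (hS : ∀ p, InCone S p) {p : W} (hp : p ≠ 0) :
    ∃ l : W →ₗ[ℝ] ℝ, (∀ s ∈ S, l s ≤ 1) ∧ ∃ a : W → ℝ, (∀ s, 0 ≤ a s) ∧
      (∀ s ∈ S, a s ≠ 0 → l s = 1) ∧ ∑ s ∈ S, a s • s = p := by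
  classical
  choose a ha hap hamin using fun p => exists_minimal_coeff S (hS p)
  -- `M` is the gauge of `conv (S ∪ {0})`; it is sublinear because minimal representations can be
  -- scaled and added.
  set M : W → ℝ := fun p => ∑ s, a p s with hM
  have hM0 : ∀ p, 0 ≤ M p := fun p => Finset.sum_nonneg fun s _ => ha p s
  have hMle : ∀ c : ℝ, 0 < c → ∀ x, M (c • x) ≤ c * M x := by
    intro c hc x
    have := hamin (c • x) (c • a x) (smul_nonneg hc.le (ha x))
      (by
        simp only [Pi.smul_apply, smul_eq_mul, mul_smul]
        rw [← Finset.smul_sum, hap])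
    simpa [hM, Finset.mul_sum] using this
  have hMhom : ∀ c : ℝ, 0 < c → ∀ x, M (c • x) = c * M x := by
    intro c hc x
    refine le_antisymm (hMle c hc x) ?_
    have := hMle c⁻¹ (inv_pos.2 hc) (c • x)
    rw [inv_smul_smul₀ hc.ne'] at this
    rwa [← le_inv_mul_iff₀ hc]
  have hMadd : ∀ x y, M (x + y) ≤ M x + M y := by
    intro x y
    have := hamin (x + y) (a x + a y) (add_nonneg (ha x) (ha y))
      (by
        simp only [Pi.add_apply, add_smul]
        rw [Finset.sum_add_distrib, hap, hap])
    simpa [hM, Finset.sum_add_distrib] using this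
  -- Hahn–Banach: extend `c • p ↦ c * M p` from the line through `p` to a functional below the
  -- gauge.
  obtain ⟨l, hl, hlM⟩ := exists_extension_of_le_sublinear
    (LinearPMap.mkSpanSingleton p (M p) hp) M hMhom hMadd (by
      rintro ⟨x, hx⟩
      obtain ⟨c, rfl⟩ := Submodule.mem_span_singleton.1 hx
      erw [LinearPMap.mkSpanSingleton'_apply]
      simp only [RingHom.id_apply, smul_eq_mul]
      rcases le_or_gt c 0 with hc | hc
      · exact (mul_nonpos_of_nonpos_of_nonneg hc (hM0 p)).trans (hM0 _)
      · exact (hMhom c hc p).ge)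
  have hlp : l p = M p := by
    have := hl ⟨p, Submodule.mem_span_singleton_self p⟩
    rw [this]
    exact LinearPMap.mkSpanSingleton_apply _ _ hp (M p)
  have hls : ∀ s ∈ S, l s ≤ 1 := by
    intro s hs
    refine (hlM s).trans ?_
    have := hamin s (Pi.single ⟨s, hs⟩ 1) (by simp) (by simp [Pi.single_apply, ite_smul])
    simpa [hM] using this
  -- Complementary slackness: since `l p = M p`, only generators with `l s = 1` occur in the minimal
  -- representation.
  have hsum : ∑ s : S, a p s * (1 - l s) = 0 := by
    have h1 : l p = ∑ s : S, a p s * l s := by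
      conv_lhs => rw [← hap p]
      simp
    rw [hlp] at h1
    simp only [mul_sub, mul_one, Finset.sum_sub_distrib]
    rw [← h1, sub_self]
  have hzero := (Finset.sum_eq_zero_iff_of_nonneg
    (fun (s : S) _ => mul_nonneg (ha p s) (sub_nonneg.2 (hls s s.2)))).1 hsum
  refine ⟨l, hls, fun s => if h : s ∈ S then a p ⟨s, h⟩ else 0, ?_, ?_, ?_⟩
  · intro s
    dsimp only
    split_ifs with h
    · exact ha p ⟨s, h⟩
    · exact le_rfl
  · intro s hs has
    simp only [dif_pos hs] at has
    have := (mul_eq_zero.1 (hzero ⟨s, hs⟩ (Finset.mem_univ _))).resolve_left has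
    exact (sub_eq_zero.1 this).symm
  · rw [← Finset.sum_coe_sort S]
    refine Eq.trans (Finset.sum_congr rfl fun s _ => ?_) (hap p)
    simp

omit [FiniteDimensional ℝ W] in
theorem vectorSpan_of_zero_mem {P : Set W} (h0 : (0 : W) ∈ P) :
    vectorSpan ℝ P = Submodule.span ℝ P := by
  rw [vectorSpan_eq_span_vsub_set_right ℝ h0]
  simp

omit [FiniteDimensional ℝ W] in
theorem InCone.mem_span {S : Finset W} {p : W} (h : InCone S p) :
    p ∈ Submodule.span ℝ (S : Set W) := by
  obtain ⟨a, -, rfl⟩ := h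
  exact Submodule.sum_mem _ fun s hs => Submodule.smul_mem _ _ (Submodule.subset_span hs)

omit [FiniteDimensional ℝ W] in
theorem affDim_eq_finrank {S : Finset W} (h0 : (0 : W) ∈ S) (hS : ∀ p, InCone S p) :
    affDim (convexHull ℝ (S : Set W)) = finrank ℝ W := by
  have hsub : (S : Set W) ⊆ convexHull ℝ (S : Set W) := subset_convexHull ℝ _
  have htop : Submodule.span ℝ (convexHull ℝ (S : Set W)) = ⊤ :=
    eq_top_iff.2 fun p _ => Submodule.span_mono hsub (hS p).mem_span
  rw [affDim, vectorSpan_of_zero_mem (hsub h0), htop, finrank_top]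

omit [FiniteDimensional ℝ W] in
theorem map_le_of_mem_convexHull {S : Set W} {l : W →ₗ[ℝ] ℝ} {c : ℝ} (h : ∀ s ∈ S, l s ≤ c)
    {x : W} (hx : x ∈ convexHull ℝ S) : l x ≤ c :=
  convexHull_min (t := {x | l x ≤ c}) h (convex_halfSpace_le l.isLinear c) hx

/-- The directions of the face lie in the proper subspace `ker l`, and together with one point of
`A` they span everything, so the codimension is exactly 1. -/
theorem isFacet_of_span_eq_top {S : Finset W} (h0 : (0 : W) ∈ S) (hS : ∀ p, InCone S p)
    {l : W →ₗ[ℝ] ℝ} (hl : ∀ s ∈ S, l s ≤ 1) {A : Set W} (hAS : A ⊆ S) (hA : ∀ s ∈ A, l s = 1)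
    (hAne : A.Nonempty) (hspan : Submodule.span ℝ A = ⊤) :
    IsFacet (convexHull ℝ (S : Set W)) {x ∈ convexHull ℝ (S : Set W) | l x = 1} := by
  set F := {x ∈ convexHull ℝ (S : Set W) | l x = 1} with hF
  have hAF : A ⊆ F := fun s hs => ⟨subset_convexHull ℝ _ (hAS hs), hA s hs⟩
  refine ⟨⟨l, 1, fun x hx => map_le_of_mem_convexHull hl hx, rfl⟩, hAne.mono hAF, ?_⟩
  rw [affDim_eq_finrank h0 hS, affDim]
  obtain ⟨s₀, hs₀⟩ := hAne
  apply le_antisymm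
  · have hle : vectorSpan ℝ F ≤ LinearMap.ker l := by
      rw [vectorSpan_def, Submodule.span_le]
      rintro _ ⟨x, hx, y, hy, rfl⟩
      simp [hx.2, hy.2]
    have hlt : LinearMap.ker l < ⊤ := by
      rw [lt_top_iff_ne_top]
      intro h
      have : s₀ ∈ LinearMap.ker l := h ▸ Submodule.mem_top
      rw [LinearMap.mem_ker, hA s₀ hs₀] at this
      exact one_ne_zero this
    exact (Submodule.finrank_mono hle).trans_lt (Submodule.finrank_lt hlt.ne)
  · have hle : (⊤ : Submodule ℝ W) ≤ vectorSpan ℝ F ⊔ Submodule.span ℝ {s₀} := by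
      rw [← hspan, Submodule.span_le]
      intro s hs
      have h1 : s - s₀ ∈ vectorSpan ℝ F := vsub_mem_vectorSpan ℝ (hAF hs) (hAF hs₀)
      have := Submodule.add_mem_sup h1 (Submodule.mem_span_singleton_self (R := ℝ) s₀)
      simpa using this
    have h1 := Submodule.finrank_mono hle
    rw [finrank_top] at h1
    have h2 := Submodule.finrank_add_le_finrank_add_finrank (vectorSpan ℝ F)
      (Submodule.span ℝ {s₀})
    have h3 := finrank_span_singleton (K := ℝ) (v := s₀) (by
      rintro rfl
      have := hA 0 hs₀
      simp at this)
    omega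

-- The level `c` can be scaled to 1 unless it is 0. But `c = 0` would give `l ≤ 0` on the cone over
-- `S`, which is the whole space; then `l = 0` and the face is all of the polytope.
omit [FiniteDimensional ℝ W] in
theorem IsFacet.exists_normal {S : Finset W} (h0 : (0 : W) ∈ S) (hS : ∀ p, InCone S p)
    {σ : Set W} (hσ : IsFacet (convexHull ℝ (S : Set W)) σ) :
    ∃ l : W →ₗ[ℝ] ℝ, (∀ x ∈ convexHull ℝ (S : Set W), l x ≤ 1) ∧
      σ = {x ∈ convexHull ℝ (S : Set W) | l x = 1} := by
  obtain ⟨⟨l, c, hl, rfl⟩, -, hdim⟩ := hσ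
  have hsub : (S : Set W) ⊆ convexHull ℝ (S : Set W) := subset_convexHull ℝ _
  have hc0 : 0 ≤ c := by simpa using hl 0 (hsub h0)
  have hc : c ≠ 0 := by
    rintro rfl
    have hle : ∀ p, l p ≤ 0 := by
      intro p
      obtain ⟨a, ha, rfl⟩ := hS p
      rw [map_sum]
      refine Finset.sum_nonpos fun s hs => ?_
      rw [map_smul, smul_eq_mul]
      exact mul_nonpos_of_nonneg_of_nonpos (ha s) (hl s (hsub hs))
    have heq : ∀ p, l p = 0 := fun p => le_antisymm (hle p) (by simpa using hle (-p))
    simp [heq] at hdim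
  have hcpos : 0 < c := lt_of_le_of_ne hc0 hc.symm
  refine ⟨c⁻¹ • l, fun x hx => ?_, ?_⟩
  · simpa [inv_mul_le_iff₀ hcpos] using hl x hx
  · ext x
    simp [inv_mul_eq_iff_eq_mul₀ hc]

omit [FiniteDimensional ℝ W] in
theorem IsFace.isExtreme {P F : Set W} (h : IsFace P F) : IsExtreme ℝ P F := by
  obtain ⟨l, c, hl, rfl⟩ := h
  rw [isExtreme_iff]
  refine ⟨fun x hx => hx.1, ?_⟩
  rintro x hx y hy z hz ⟨a, b, ha, hb, hab, rfl⟩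
  refine ⟨hx, ?_⟩
  have hz2 : a * l x + b * l y = c := by simpa using hz.2
  have h1 := hl x hx
  have h2 := hl y hy
  by_contra hne
  have h3 : a * l x < a * c := mul_lt_mul_of_pos_left (lt_of_le_of_ne h1 hne) ha
  have h4 : b * l y ≤ b * c := mul_le_mul_of_nonneg_left h2 hb.le
  have h5 : a * c + b * c = c := by rw [← add_mul, hab, one_mul]
  linarith

/-- The facets of `P = conv S` are triangulated without new vertices. -/
structure FacetTriangulation (S : Finset W) (T : Set W → Finset (Finset W)) : Prop where
  zero_mem : (0 : W) ∈ S
  inCone : ∀ p, InCone S p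
  triangulation : ∀ σ, IsFacet (convexHull ℝ (S : Set W)) σ → IsTriangulation σ (T σ)
  vertices : ∀ σ, IsFacet (convexHull ℝ (S : Set W)) σ → ∀ Δ ∈ T σ,
    (Δ : Set W) ⊆ σ.extremePoints ℝ

/-! ### The complete fan of cones over the triangulated facets. -/

namespace FacetTriangulation

variable {S : Finset W} {T : Set W → Finset (Finset W)}

/-- The maximal simplices of the triangulations of all facets. -/
def simplices (S : Finset W) (T : Set W → Finset (Finset W)) : Set (Finset W) :=
  {Δ | ∃ σ, IsFacet (convexHull ℝ (S : Set W)) σ ∧ Δ ∈ T σ}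

omit [FiniteDimensional ℝ W] in
theorem subset_extremePoints (h : FacetTriangulation S T) {Δ : Finset W}
    (hΔ : Δ ∈ simplices S T) : (Δ : Set W) ⊆ (convexHull ℝ (S : Set W)).extremePoints ℝ := by
  obtain ⟨σ, hσ, hΔ⟩ := hΔ
  exact (h.vertices σ hσ Δ hΔ).trans hσ.1.isExtreme.extremePoints_subset_extremePoints

omit [FiniteDimensional ℝ W] in
theorem subset_generators (h : FacetTriangulation S T) {Δ : Finset W}
    (hΔ : Δ ∈ simplices S T) : Δ ⊆ S := by
  have := (h.subset_extremePoints hΔ).trans extremePoints_convexHull_subset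
  exact_mod_cast this

omit [FiniteDimensional ℝ W] in
theorem finite_simplices (h : FacetTriangulation S T) : (simplices S T).Finite := by
  refine (S.powerset.finite_toSet).subset fun Δ hΔ => ?_
  simpa using h.subset_generators hΔ

-- The vertices lie on the hyperplane `l = 1`, so applying `l` to a linear relation shows that its
-- coefficients sum to zero; affine independence then applies.
omit [FiniteDimensional ℝ W] in
theorem linearIndependent (h : FacetTriangulation S T) {Δ : Finset W}
    (hΔ : Δ ∈ simplices S T) : LinearIndependent ℝ (fun v : Δ => (v : W)) := by
  obtain ⟨σ, hσ, hΔ⟩ := hΔ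
  obtain ⟨l, -, hl⟩ := hσ.exists_normal h.zero_mem h.inCone
  have hind := (h.triangulation σ hσ).indep Δ hΔ
  rw [affineIndependent_iff] at hind
  rw [linearIndependent_iff']
  intro s g hg
  refine hind s g ?_ hg
  have hone : ∀ v ∈ Δ, l v = 1 := by
    intro v hv
    have := extremePoints_subset (h.vertices σ hσ Δ hΔ hv)
    rw [hl] at this
    exact this.2
  have := congrArg l hg
  rw [map_sum, map_zero] at this
  rw [← this]
  refine Finset.sum_congr rfl fun v _ => ?_
  simp [hone v v.2]

omit [FiniteDimensional ℝ W] in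
theorem card_eq (h : FacetTriangulation S T) {Δ : Finset W}
    (hΔ : Δ ∈ simplices S T) : Δ.card = finrank ℝ W := by
  obtain ⟨σ, hσ, hΔ⟩ := hΔ
  rw [(h.triangulation σ hσ).card_eq Δ hΔ, hσ.2.2, affDim_eq_finrank h.zero_mem h.inCone]

/-- The basis consisting of the vertices of a simplex. -/
def basis (h : FacetTriangulation S T) {Δ : Finset W} (hΔ : Δ ∈ simplices S T) :
    Basis Δ ℝ W :=
  Basis.mk (h.linearIndependent hΔ) (by
    have := (h.linearIndependent hΔ).span_eq_top_of_card_eq_finrank' (by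
      rw [Fintype.card_coe, h.card_eq hΔ])
    rw [this])

@[simp] theorem basis_apply (h : FacetTriangulation S T) {Δ : Finset W} (hΔ : Δ ∈ simplices S T)
    (v : Δ) : h.basis hΔ v = v := by
  simp [basis]

omit [FiniteDimensional ℝ W] in
theorem exists_normal (h : FacetTriangulation S T) {Δ : Finset W} (hΔ : Δ ∈ simplices S T) :
    ∃ l : W →ₗ[ℝ] ℝ, (∀ s ∈ S, l s ≤ 1) ∧ ∀ v ∈ Δ, l v = 1 := by
  obtain ⟨σ, hσ, hΔ⟩ := hΔ
  obtain ⟨l, hl, hσl⟩ := hσ.exists_normal h.zero_mem h.inCone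
  refine ⟨l, fun s hs => hl s (subset_convexHull ℝ _ hs), fun v hv => ?_⟩
  have := extremePoints_subset (h.vertices σ hσ Δ hΔ hv)
  rw [hσl] at this
  exact this.2

/-- A vector in no proper subspace spanned by elements of `S`. -/
def Generic (S : Finset W) (p : W) : Prop :=
  ∀ A : Set W, A ⊆ S → p ∈ Submodule.span ℝ A → Submodule.span ℝ A = ⊤

/-- A vanishing coordinate would put `p` in the proper subspace spanned by the other vertices of
`Δ`. -/
theorem repr_ne_zero (h : FacetTriangulation S T) {Δ : Finset W} (hΔ : Δ ∈ simplices S T)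
    {p : W} (hp : Generic S p) (v : Δ) : (h.basis hΔ).repr p v ≠ 0 := by
  classical
  intro h0
  have hle : Submodule.span ℝ ((Δ : Set W) \ {(v : W)}) ≤ LinearMap.ker ((h.basis hΔ).coord v) := by
    rw [Submodule.span_le]
    rintro s ⟨hs, hsv⟩
    have := h.basis_apply hΔ ⟨s, hs⟩
    simp only [SetLike.mem_coe, LinearMap.mem_ker, Basis.coord_apply]
    rw [show s = h.basis hΔ ⟨s, hs⟩ from this.symm, Basis.repr_self, Finsupp.single_apply, if_neg]
    rintro rfl
    exact hsv rfl
  have hmem : p ∈ Submodule.span ℝ ((Δ : Set W) \ {(v : W)}) := by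
    rw [← (h.basis hΔ).sum_repr p]
    refine Submodule.sum_mem _ fun s _ => ?_
    by_cases hs : s = v
    · rw [hs, h0, zero_smul]; exact Submodule.zero_mem _
    · refine Submodule.smul_mem _ _ (Submodule.subset_span ?_)
      rw [basis_apply]
      exact ⟨s.2, fun hsv => hs (Subtype.ext hsv)⟩
  have htop := hp _ (Set.sdiff_subset.trans (by exact_mod_cast h.subset_generators hΔ)) hmem
  rw [htop] at hle
  have : h.basis hΔ v ∈ LinearMap.ker ((h.basis hΔ).coord v) := hle Submodule.mem_top
  rw [LinearMap.mem_ker, Basis.coord_apply, Basis.repr_self, Finsupp.single_eq_same] at this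
  exact one_ne_zero this

/-- The generators carrying a minimal representation of `p` span the space by genericity, so the
supporting functional cuts out a facet. Scaled into that facet, `p` lies in some simplex; its
coordinates are nonnegative there, and nonzero by genericity. -/
theorem exists_pos (h : FacetTriangulation S T) (hn : 0 < finrank ℝ W) {p : W}
    (hp : Generic S p) : ∃ Δ, ∃ hΔ : Δ ∈ simplices S T, ∀ v, 0 < (h.basis hΔ).repr p v := by
  classical
  have hp0 : p ≠ 0 := by
    rintro rfl
    have := hp ∅ (Set.empty_subset _) (Submodule.zero_mem _)
    rw [Submodule.span_empty] at this
    have h1 := finrank_top ℝ W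
    rw [← this, finrank_bot] at h1
    omega
  obtain ⟨l, hl, a, ha, hal, hap⟩ := exists_supporting S h.inCone hp0
  set A : Set W := {s ∈ (S : Set W) | a s ≠ 0} with hA
  have hAS : A ⊆ S := fun s hs => hs.1
  have hA1 : ∀ s ∈ A, l s = 1 := fun s hs => hal s hs.1 hs.2
  have hpA : p ∈ Submodule.span ℝ A := by
    rw [← hap]
    refine Submodule.sum_mem _ fun s hs => ?_
    by_cases h0 : a s = 0
    · rw [h0, zero_smul]; exact Submodule.zero_mem _
    · exact Submodule.smul_mem _ _ (Submodule.subset_span ⟨hs, h0⟩)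
  have hAne : A.Nonempty := by
    by_contra hne
    rw [Set.not_nonempty_iff_eq_empty] at hne
    rw [hne, Submodule.span_empty] at hpA
    exact hp0 hpA
  have hF := isFacet_of_span_eq_top h.zero_mem h.inCone hl hAS hA1 hAne (hp A hAS hpA)
  set c := ∑ s ∈ S, a s with hc
  have hcpos : 0 < c := by
    obtain ⟨s, hs⟩ := hAne
    exact Finset.sum_pos' (fun s _ => ha s) ⟨s, hs.1, lt_of_le_of_ne (ha s) hs.2.symm⟩
  have hmem : c⁻¹ • p ∈ {x ∈ convexHull ℝ (S : Set W) | l x = 1} := by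
    constructor
    · rw [← hap, Finset.smul_sum]
      simp only [smul_smul]
      refine (convex_convexHull ℝ _).sum_mem (fun s _ => mul_nonneg (inv_pos.2 hcpos).le (ha s)) ?_
        fun s hs => subset_convexHull ℝ _ hs
      rw [← Finset.mul_sum, ← hc, inv_mul_cancel₀ hcpos.ne']
    · rw [map_smul, ← hap, map_sum, smul_eq_mul, inv_mul_eq_iff_eq_mul₀ hcpos.ne', mul_one, hc]
      refine Finset.sum_congr rfl fun s hs => ?_
      rw [map_smul, smul_eq_mul]
      by_cases h0 : a s = 0
      · rw [h0, zero_mul]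
      · rw [hal s hs h0, mul_one]
  rw [(h.triangulation _ hF).union_eq] at hmem
  simp only [Set.mem_iUnion] at hmem
  obtain ⟨Δ, hΔ, hmem⟩ := hmem
  have hΔ' : Δ ∈ simplices S T := ⟨_, hF, hΔ⟩
  refine ⟨Δ, hΔ', fun v => lt_of_le_of_ne ?_ (h.repr_ne_zero hΔ' hp v).symm⟩
  have hnn : 0 ≤ (h.basis hΔ').coord v (c⁻¹ • p) := by
    refine convexHull_min (t := {x | 0 ≤ (h.basis hΔ').coord v x}) ?_
      (convex_halfSpace_ge ((h.basis hΔ').coord v).isLinear 0) hmem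
    intro s hs
    rw [Set.mem_ofPred_eq, show s = h.basis hΔ' ⟨s, hs⟩ from (h.basis_apply hΔ' ⟨s, hs⟩).symm,
      Basis.coord_apply, Basis.repr_self, Finsupp.single_apply]
    split_ifs <;> norm_num
  rw [map_smul, smul_eq_mul, Basis.coord_apply] at hnn
  exact (mul_nonneg_iff_of_pos_left (inv_pos.2 hcpos)).1 hnn

/-- Interiors of distinct cones are disjoint. The proof first identifies the two facets through
their normals, then the two simplices through the face condition of the triangulation. -/
theorem eq_of_pos (h : FacetTriangulation S T) (hn : 0 < finrank ℝ W) {p : W} {Δ Δ' : Finset W}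
    (hΔ : Δ ∈ simplices S T) (hΔ' : Δ' ∈ simplices S T)
    (hp : ∀ v, 0 < (h.basis hΔ).repr p v) (hp' : ∀ v, 0 < (h.basis hΔ').repr p v) : Δ = Δ' := by
  have hcΔ := hΔ
  have hcΔ' := hΔ'
  set c := (h.basis hcΔ).repr p with hc
  set c' := (h.basis hcΔ').repr p with hc'
  have hpc : p = ∑ v : Δ, c v • (v : W) := by
    conv_lhs => rw [← (h.basis hcΔ).sum_repr p]
    simp [hc]
  have hpc' : p = ∑ v : Δ', c' v • (v : W) := by
    conv_lhs => rw [← (h.basis hcΔ').sum_repr p]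
    simp [hc']
  obtain ⟨σ, hσ, hT⟩ := hΔ
  obtain ⟨σ', hσ', hT'⟩ := hΔ'
  obtain ⟨l, hl, hσl⟩ := hσ.exists_normal h.zero_mem h.inCone
  obtain ⟨l', hl', hσl'⟩ := hσ'.exists_normal h.zero_mem h.inCone
  have hv := h.vertices σ hσ Δ hT
  have hv' := h.vertices σ' hσ' Δ' hT'
  have hmem : ∀ v ∈ Δ, v ∈ convexHull ℝ (S : Set W) ∧ l v = 1 := fun v hvΔ => by
    have := extremePoints_subset (hv hvΔ)
    rwa [hσl] at this
  have hmem' : ∀ v ∈ Δ', v ∈ convexHull ℝ (S : Set W) ∧ l' v = 1 := fun v hvΔ => by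
    have := extremePoints_subset (hv' hvΔ)
    rwa [hσl'] at this
  have e1 : l p = ∑ v : Δ, c v := by
    rw [hpc]; simp [(hmem _ (Subtype.prop _)).2]
  have e1' : l' p = ∑ v : Δ', c' v := by
    rw [hpc']; simp [(hmem' _ (Subtype.prop _)).2]
  have e2 : l' p = ∑ v : Δ, c v * l' v := by
    conv_lhs => rw [hpc]
    simp
  have e2' : l p = ∑ v : Δ', c' v * l v := by
    conv_lhs => rw [hpc']
    simp
  -- The own normal adds up the coordinates of `p`, and the other normal is at most 1 on each
  -- vertex. Both inequalities hold, and equality with positive coordinates forces `l' = 1` on all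
  -- of `Δ`.
  have i1 : l' p ≤ l p := by
    rw [e1, e2]
    exact Finset.sum_le_sum fun v _ =>
      mul_le_of_le_one_right (hp v).le (hl' v (hmem v v.2).1)
  have i2 : l p ≤ l' p := by
    rw [e1', e2']
    exact Finset.sum_le_sum fun v _ =>
      mul_le_of_le_one_right (hp' v).le (hl v (hmem' v v.2).1)
  have heq : l p = l' p := le_antisymm i2 i1
  have hone : ∀ v : Δ, l' v = 1 := by
    have hz : ∑ v : Δ, c v * (1 - l' v) = 0 := by
      simp only [mul_sub, mul_one, Finset.sum_sub_distrib]
      rw [← e1, ← e2, heq, sub_self]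
    intro v
    have := (Finset.sum_eq_zero_iff_of_nonneg (fun (v : Δ) _ =>
      mul_nonneg (hp v).le (sub_nonneg.2 (hl' v (hmem v v.2).1)))).1 hz v (Finset.mem_univ v)
    exact (sub_eq_zero.1 ((mul_eq_zero.1 this).resolve_left (hp v).ne')).symm
  have hll : l = l' := by
    refine (h.basis hcΔ).ext fun v => ?_
    rw [basis_apply, hone, (hmem v v.2).2]
  have hσσ : σ = σ' := by rw [hσl, hσl', hll]
  subst hσσ
  set r := ∑ v : Δ, c v with hr
  have hrpos : 0 < r := by
    have : Nonempty Δ := by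
      rw [← Fintype.card_pos_iff, Fintype.card_coe, h.card_eq hcΔ]; exact hn
    exact Finset.sum_pos (fun v _ => hp v) Finset.univ_nonempty
  have hr' : r = ∑ v : Δ', c' v := by rw [← e1, heq, e1']
  have hq : r⁻¹ • p ∈ convexHull ℝ (Δ : Set W) := by
    rw [hpc, Finset.smul_sum]
    simp only [smul_smul]
    refine (convex_convexHull ℝ _).sum_mem (fun v _ => mul_nonneg (inv_pos.2 hrpos).le (hp v).le) ?_
      fun v _ => subset_convexHull ℝ _ v.2
    rw [← Finset.mul_sum, ← hr, inv_mul_cancel₀ hrpos.ne']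
  have hq' : r⁻¹ • p ∈ convexHull ℝ (Δ' : Set W) := by
    rw [hpc', Finset.smul_sum]
    simp only [smul_smul]
    refine (convex_convexHull ℝ _).sum_mem
      (fun v _ => mul_nonneg (inv_pos.2 hrpos).le (hp' v).le) ?_
      fun v _ => subset_convexHull ℝ _ v.2
    rw [← Finset.mul_sum, ← hr', inv_mul_cancel₀ hrpos.ne']
  obtain ⟨m, k, hm, hface⟩ := (h.triangulation σ hσ).inter_face Δ hT Δ' hT'
  have hmk : m (r⁻¹ • p) = k := by
    have : r⁻¹ • p ∈ convexHull ℝ (Δ : Set W) ∩ convexHull ℝ (Δ' : Set W) := ⟨hq, hq'⟩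
    rw [hface] at this
    exact this.2
  -- The common face contains an interior point of `Δ`, so its defining inequality is an equality at
  -- every vertex.
  have hmv : ∀ v : Δ, m v = k := by
    have hz : ∑ v : Δ, c v * (k - m v) = 0 := by
      rw [map_smul, smul_eq_mul, inv_mul_eq_iff_eq_mul₀ hrpos.ne'] at hmk
      have : m p = ∑ v : Δ, c v * m v := by
        conv_lhs => rw [hpc]
        simp
      simp only [mul_sub, Finset.sum_sub_distrib]
      rw [← this, hmk, hr, Finset.sum_mul, sub_self]
    intro v
    have := (Finset.sum_eq_zero_iff_of_nonneg (fun (v : Δ) _ =>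
      mul_nonneg (hp v).le (sub_nonneg.2 (hm v (subset_convexHull ℝ _ v.2))))).1 hz v
      (Finset.mem_univ v)
    exact (sub_eq_zero.1 ((mul_eq_zero.1 this).resolve_left (hp v).ne')).symm
  -- A vertex of `Δ` is extreme in `σ`, hence extreme in the smaller set `conv Δ'` that contains it,
  -- hence a vertex of `Δ'`.
  have hsub : Δ ⊆ Δ' := by
    intro v hvΔ
    have h1 : v ∈ convexHull ℝ (Δ' : Set W) := by
      have : v ∈ convexHull ℝ (Δ : Set W) ∩ convexHull ℝ (Δ' : Set W) := by
        rw [hface]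
        exact ⟨subset_convexHull ℝ _ hvΔ, hmv ⟨v, hvΔ⟩⟩
      exact this.2
    have h2 : convexHull ℝ (Δ' : Set W) ⊆ σ := by
      rw [(h.triangulation σ hσ).union_eq]
      exact Set.subset_biUnion_of_mem (u := fun Δ : Finset W => convexHull ℝ (Δ : Set W)) hT'
    exact extremePoints_convexHull_subset
      (inter_extremePoints_subset_extremePoints_of_subset h2 ⟨h1, hv hvΔ⟩)
  exact Finset.eq_of_subset_of_card_le hsub (by rw [h.card_eq hcΔ, h.card_eq hcΔ'])

-- A real vector space is not a finite union of proper subspaces.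
omit [FiniteDimensional ℝ W] in
theorem exists_generic (S : Finset W) : ∃ ξ : W, Generic S ξ := by
  classical
  set Hs : Finset (Submodule ℝ W) :=
    (S.powerset.image fun A : Finset W => Submodule.span ℝ (A : Set W)).filter (· ≠ ⊤) with hHs
  have hne := Subspace.biUnion_ne_univ_of_top_notMem (s := Hs) (by simp [hHs])
  obtain ⟨ξ, hξ⟩ := (Set.ne_univ_iff_exists_notMem _).1 hne
  refine ⟨ξ, fun A hA hmem => ?_⟩
  by_contra hcon
  apply hξ
  have hfin : A.Finite := S.finite_toSet.subset hA
  refine Set.mem_biUnion (x := Submodule.span ℝ A) ?_ hmem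
  simp only [hHs, Finset.coe_filter, Set.mem_ofPred_eq]
  refine ⟨Finset.mem_image.2 ⟨hfin.toFinset, ?_, by simp⟩, hcon⟩
  rw [Finset.mem_powerset]
  intro s hs
  exact hA (by simpa using hs)

omit [FiniteDimensional ℝ W] in
theorem Generic.neg {ξ : W} (hξ : Generic S ξ) : Generic S (-ξ) :=
  fun A hA h => hξ A hA (by simpa using h)

-- Each of the finitely many proper spans contains `p + ε • ξ` for at most one `ε`, since two values
-- would put `ξ` itself in the span.
open Filter Topology in
omit [FiniteDimensional ℝ W] in
theorem Generic.eventually_add_smul {ξ : W} (hξ : Generic S ξ) (p : W) :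
    ∀ᶠ ε in 𝓝[>] (0 : ℝ), Generic S (p + ε • ξ) := by
  classical
  have hA : ∀ A ∈ S.powerset, ∀ᶠ ε in 𝓝[>] (0 : ℝ),
      p + ε • ξ ∈ Submodule.span ℝ (A : Set W) → Submodule.span ℝ (A : Set W) = ⊤ := by
    intro A hA
    by_cases htop : Submodule.span ℝ (A : Set W) = ⊤
    · simp [htop]
    have hsub : {ε : ℝ | p + ε • ξ ∈ Submodule.span ℝ (A : Set W)}.Subsingleton := by
      intro ε hε δ hδ
      by_contra hne
      have h1 : (ε - δ) • ξ ∈ Submodule.span ℝ (A : Set W) := by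
        have := Submodule.sub_mem (Submodule.span ℝ (A : Set W)) hε hδ
        simpa [sub_smul] using this
      exact htop (hξ A (by exact_mod_cast Finset.mem_powerset.1 hA)
        ((Submodule.smul_mem_iff _ (sub_ne_zero.2 hne)).1 h1))
    have hfin := hsub.finite
    have : ∀ᶠ ε in 𝓝[≠] (0 : ℝ), ε ∉ {ε : ℝ | p + ε • ξ ∈ Submodule.span ℝ (A : Set W)} := by
      have h3 : ({ε : ℝ | p + ε • ξ ∈ Submodule.span ℝ (A : Set W)} \ {0})ᶜ ∈ 𝓝 (0 : ℝ) :=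
        (hfin.subset Set.sdiff_subset).isClosed.isOpen_compl.mem_nhds (by simp)
      filter_upwards [mem_nhdsWithin_of_mem_nhds h3, self_mem_nhdsWithin] with ε h4 h5 h6
      exact h4 ⟨h6, h5⟩
    have := this.filter_mono (nhdsWithin_mono (0 : ℝ) (fun x hx => (ne_of_gt hx : x ≠ 0)))
    filter_upwards [this] with ε h4 h5
    exact absurd h5 h4
  have := (Finset.eventually_all _).2 hA
  filter_upwards [this] with ε hε A hAS hmem
  have hfin : A.Finite := S.finite_toSet.subset hAS
  have := hε hfin.toFinset (by
    rw [Finset.mem_powerset]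
    intro s hs
    exact hAS (by simpa using hs))
  simp only [Set.Finite.coe_toFinset] at this
  exact this hmem

-- Translates the wall conditions of `HalfOpen` at `p` into strict positivity at a nearby point `p +
-- ε • ξ`.
open Filter Topology in
theorem _root_.Real.eventually_add_mul_pos_iff (a b : ℝ) :
    ∀ᶠ ε in 𝓝[>] (0 : ℝ), (0 < a + ε * b ↔ 0 < a ∨ (a = 0 ∧ 0 < b)) := by
  have hlim : Tendsto (fun ε : ℝ => a + ε * b) (𝓝[>] 0) (𝓝 a) := by
    have : Continuous fun ε : ℝ => a + ε * b := by fun_prop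
    have h := this.tendsto 0
    simp only [zero_mul, add_zero] at h
    exact h.mono_left nhdsWithin_le_nhds
  rcases lt_trichotomy a 0 with ha | ha | ha
  · filter_upwards [hlim.eventually (gt_mem_nhds ha)] with ε hε
    simp [ha.not_gt, ha.ne, hε.le]
  · filter_upwards [self_mem_nhdsWithin] with ε hε
    simp [ha, mul_pos_iff_of_pos_left (show 0 < ε from hε)]
  · filter_upwards [hlim.eventually (lt_mem_nhds ha)] with ε hε
    simp [ha, hε]

/-- The part of the cone over `Δ` which is seen from a point in direction `ξ`. -/
def HalfOpen (h : FacetTriangulation S T) (ξ : W) {Δ : Finset W} (hΔ : Δ ∈ simplices S T)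
    (p : W) : Prop :=
  ∀ v, 0 < (h.basis hΔ).repr p v ∨ ((h.basis hΔ).repr p v = 0 ∧ 0 < (h.basis hΔ).repr ξ v)

/-- The half-open cones over the simplices form a partition of the space. -/
theorem existsUnique_halfOpen (h : FacetTriangulation S T) (hn : 0 < finrank ℝ W) {ξ : W}
    (hξ : Generic S ξ) (p : W) : ∃! Δ : simplices S T, h.HalfOpen ξ Δ.2 p := by
  have hfin : Finite (simplices S T) := h.finite_simplices
  have hev : ∀ᶠ ε in nhdsWithin (0 : ℝ) (Set.Ioi 0), ∀ Δ : simplices S T, ∀ v,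
      (0 < (h.basis Δ.2).repr (p + ε • ξ) v ↔ 0 < (h.basis Δ.2).repr p v ∨
        ((h.basis Δ.2).repr p v = 0 ∧ 0 < (h.basis Δ.2).repr ξ v)) := by
    rw [Filter.eventually_all]
    intro Δ
    rw [Filter.eventually_all]
    intro v
    simpa using Real.eventually_add_mul_pos_iff ((h.basis Δ.2).repr p v)
      ((h.basis Δ.2).repr ξ v)
  -- One small `ε` serves all simplices and makes `p + ε • ξ` generic; the half-open cone of `p` is
  -- the open cone containing this point.
  obtain ⟨ε, h1, h2⟩ := (hev.and (hξ.eventually_add_smul p)).exists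
  have hiff : ∀ Δ : simplices S T, h.HalfOpen ξ Δ.2 p ↔
      ∀ v, 0 < (h.basis Δ.2).repr (p + ε • ξ) v := fun Δ => forall_congr' fun v => (h1 Δ v).symm
  obtain ⟨Δ, hΔ, hpos⟩ := h.exists_pos hn h2
  refine ⟨⟨Δ, hΔ⟩, (hiff _).2 hpos, fun Δ' hΔ' => Subtype.ext ?_⟩
  exact h.eq_of_pos hn Δ'.2 hΔ ((hiff _).1 hΔ') hpos

end FacetTriangulation

end Cones

/-! ### Generating functions of the vertices in a cone -/

section Cone

variable {L V ι : Type*} [AddCommGroup L] [AddAction L V]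

/-- The generating function `∑ t ^ f(y)` over `y ∈ A`. -/
def genFun (f : V → ℕ) (A : Set V) : ℚ⟦X⟧ :=
  PowerSeries.mk fun m => ({y ∈ A | f y = m}.ncard : ℚ)

theorem genFun_eq_sum {f : V → ℕ} {A : Set V} (hA : A.Finite) :
    genFun f A = ((∑ y ∈ hA.toFinset, (Polynomial.X : ℚ[X]) ^ f y : ℚ[X]) : ℚ⟦X⟧) := by
  classical
  ext m
  rw [genFun, PowerSeries.coeff_mk, Polynomial.coeff_coe, Polynomial.finsetSum_coeff]
  simp only [Polynomial.coeff_X_pow, Finset.sum_boole]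
  norm_cast
  rw [← Set.ncard_coe_finset]
  congr 1
  ext y
  simp [eq_comm]

theorem genFun_univ_eq_sum [Fintype ι] {f : V → ℕ} (hf : ∀ m, {y | f y = m}.Finite)
    (A : ι → Set V) (hA : ∀ y, ∃! i, y ∈ A i) : genFun f Set.univ = ∑ i, genFun f (A i) := by
  classical
  choose g hg hgu using hA
  ext m
  rw [genFun, map_sum]
  simp only [genFun, PowerSeries.coeff_mk]
  norm_cast
  have hcard : ∀ i, {y ∈ A i | f y = m}.ncard = ((hf m).toFinset.filter (g · = i)).card := by
    intro i
    rw [← Set.ncard_coe_finset]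
    congr 1
    ext y
    simp only [Set.mem_ofPred_eq, Finset.coe_filter, Set.Finite.mem_toFinset]
    constructor
    · rintro ⟨h1, h2⟩
      exact ⟨h2, (hgu y i h1).symm⟩
    · rintro ⟨h1, rfl⟩
      exact ⟨hg y, h1⟩
  simp only [hcard]
  rw [← Finset.card_eq_sum_card_fiberwise (f := g) (s := (hf m).toFinset) (fun _ _ => Finset.mem_coe.2 (Finset.mem_univ _)),
    ← Set.ncard_coe_finset]
  congr 1
  ext y
  simp

/-- Telescoping along a translation. -/
theorem one_sub_X_pow_mul_genFun {f : V → ℕ} (hf : ∀ m, {y | f y = m}.Finite) {A : Set V} {u : L}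
    {e : ℕ} (hu : ∀ y ∈ A, u +ᵥ y ∈ A ∧ f (u +ᵥ y) = f y + e) :
    (1 - PowerSeries.X ^ e) * genFun f A = genFun f {y ∈ A | -u +ᵥ y ∉ A} := by
  ext m
  rw [sub_mul, one_mul, map_sub, PowerSeries.coeff_X_pow_mul', sub_eq_iff_eq_add]
  simp only [genFun, PowerSeries.coeff_mk]
  have hfin : ∀ B : Set V, {y ∈ B | f y = m}.Finite := fun B => (hf m).subset fun y hy => hy.2
  have hsplit : {y ∈ A | f y = m} =
      {y ∈ {y ∈ A | -u +ᵥ y ∉ A} | f y = m} ∪ {y ∈ {y ∈ A | -u +ᵥ y ∈ A} | f y = m} := by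
    ext y
    simp only [Set.mem_ofPred_eq, Set.mem_union]
    tauto
  have hdisj : Disjoint {y ∈ {y ∈ A | -u +ᵥ y ∉ A} | f y = m}
      {y ∈ {y ∈ A | -u +ᵥ y ∈ A} | f y = m} := by
    rw [Set.disjoint_left]
    rintro y ⟨⟨_, h1⟩, _⟩ ⟨⟨_, h2⟩, _⟩
    exact h1 h2
  rw [hsplit, Set.ncard_union_eq hdisj (hfin _) (hfin _)]
  push_cast
  congr 1
  split_ifs with hem
  · norm_cast
    -- The points that can be moved back inside `A` are the translates of points of `A` of value `m
    -- - e`; they cancel the shifted series.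
    have himg : {y ∈ {y ∈ A | -u +ᵥ y ∈ A} | f y = m} =
        (u +ᵥ ·) '' {y ∈ A | f y = m - e} := by
      ext y
      constructor
      · rintro ⟨⟨h1, h2⟩, h3⟩
        refine ⟨-u +ᵥ y, ⟨h2, ?_⟩, vadd_neg_vadd u y⟩
        have := (hu _ h2).2
        rw [vadd_neg_vadd, h3] at this
        omega
      · rintro ⟨z, ⟨h1, h2⟩, rfl⟩
        have := hu z h1
        refine ⟨⟨this.1, by simpa using h1⟩, ?_⟩
        rw [this.2, h2]
        omega
    rw [himg, Set.ncard_image_of_injective _ (AddAction.injective u)]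
  · norm_cast
    rw [Set.ncard_eq_zero (hfin _), Set.eq_empty_iff_forall_notMem]
    rintro y ⟨⟨h1, h2⟩, h3⟩
    have := (hu _ h2).2
    rw [vadd_neg_vadd, h3] at this
    omega

/-! ### Distances in a simplicial cone, and the numerators of its generating functions. -/

variable [Fintype ι]

/-- Coordinates with respect to a simplicial cone such that the points of the cone
lie on geodesics from `x₀` to the translates of `x₀` along the generators. -/
structure IsGeodesicCone (D : V → V → ℕ) (x₀ : V) (c : V → ι → ℝ) (ρ : L →+ (ι → ℝ)) (w : ι → L)
    (d : ι → ℕ) : Prop where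
  self : D x₀ x₀ = 0
  triangle : ∀ x y z, D x z ≤ D x y + D y z
  comm : ∀ x y, D x y = D y x
  vadd : ∀ (u : L) x y, D (u +ᵥ x) (u +ᵥ y) = D x y
  pos : ∀ i, 0 < d i
  coord_base : c x₀ = 0
  coord_vadd : ∀ u y, c (u +ᵥ y) = ρ u + c y
  coord_generator : ∀ i j, ρ (w i) j = (open Classical in if j = i then (d i : ℝ) else 0)
  lower : ∀ k : ι → ℕ, ∑ i, k i * d i ≤ D x₀ ((∑ i, k i • w i) +ᵥ x₀)
  box : ∀ (s : Finset ι) (y : V), (∀ i, 0 ≤ c y i ∧ c y i < d i) → (∀ i ∉ s, c y i = 0) →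
    D x₀ y + D y ((∑ i ∈ s, w i) +ᵥ x₀) = ∑ i ∈ s, d i

namespace IsGeodesicCone

variable {D : V → V → ℕ} {x₀ : V} {c : V → ι → ℝ} {ρ : L →+ (ι → ℝ)} {w : ι → L} {d : ι → ℕ}

theorem coord_sum (h : IsGeodesicCone D x₀ c ρ w d) (k : ι → ℕ) (j : ι) :
    ρ (∑ i, k i • w i) j = k j * d j := by
  classical
  rw [map_sum, Finset.sum_apply, Finset.sum_eq_single j]
  · simp [h.coord_generator]
  · intro i _ hij
    simp [h.coord_generator, hij.symm]
  · simp

theorem dist_generator (h : IsGeodesicCone D x₀ c ρ w d) (i : ι) : D x₀ (w i +ᵥ x₀) = d i := by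
  have := h.box {i} x₀ (fun j => by simp [h.coord_base, h.pos]) (fun j _ => by simp [h.coord_base])
  simpa [h.self] using this

theorem dist_add_le (h : IsGeodesicCone D x₀ c ρ w d) (u v : L) :
    D x₀ ((u + v) +ᵥ x₀) ≤ D x₀ (u +ᵥ x₀) + D x₀ (v +ᵥ x₀) := by
  refine (h.triangle x₀ (u +ᵥ x₀) _).trans (add_le_add le_rfl ?_)
  rw [add_vadd, h.vadd]

theorem dist_nsmul_le (h : IsGeodesicCone D x₀ c ρ w d) (m : ℕ) (i : ι) :
    D x₀ ((m • w i) +ᵥ x₀) ≤ m * d i := by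
  induction m with
  | zero => simp [h.self]
  | succ m ih =>
    rw [succ_nsmul, add_mul, one_mul]
    exact (h.dist_add_le _ _).trans (add_le_add ih (h.dist_generator i).le)

theorem upper (h : IsGeodesicCone D x₀ c ρ w d) (k : ι → ℕ) :
    D x₀ ((∑ i, k i • w i) +ᵥ x₀) ≤ ∑ i, k i * d i := by
  classical
  have : ∀ s : Finset ι, D x₀ ((∑ i ∈ s, k i • w i) +ᵥ x₀) ≤ ∑ i ∈ s, k i * d i := by
    intro s
    induction s using Finset.induction_on with
    | empty => simp [h.self]
    | insert i s his ih =>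
      rw [Finset.sum_insert his, Finset.sum_insert his]
      exact (h.dist_add_le _ _).trans (add_le_add (h.dist_nsmul_le _ _) ih)
  exact this _

/-- Points of the cone lie on geodesics. -/
theorem geodesic (h : IsGeodesicCone D x₀ c ρ w d) {y : V} {k : ι → ℕ}
    (hy : ∀ i, 0 ≤ c y i ∧ c y i ≤ k i * d i) :
    D x₀ y + D y ((∑ i, k i • w i) +ᵥ x₀) = ∑ i, k i * d i := by
  classical
  -- `m` moves `y` back into the fundamental box. `s` collects the directions in which `y` has not
  -- reached the far corner; in the others the remainder of `y` is 0, as `box` requires outside `s`.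
  set m : ι → ℕ := fun i => ⌊c y i / d i⌋₊ with hm
  set s : Finset ι := Finset.univ.filter fun i => c y i < k i * d i with hs
  have hdpos : ∀ i, (0 : ℝ) < d i := fun i => by exact_mod_cast h.pos i
  have hm1 : ∀ i, m i * (d i : ℝ) ≤ c y i := fun i => by
    rw [← le_div_iff₀ (hdpos i)]
    exact Nat.floor_le (div_nonneg (hy i).1 (hdpos i).le)
  have hm2 : ∀ i, c y i < (m i + 1) * (d i : ℝ) := fun i => by
    rw [← div_lt_iff₀ (hdpos i)]
    exact Nat.lt_floor_add_one _
  have hms : ∀ i ∉ s, m i = k i ∧ c y i = m i * d i := by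
    intro i hi
    have heq : c y i = k i * d i := by
      simp only [hs, Finset.mem_filter, Finset.mem_univ, true_and, not_lt] at hi
      exact le_antisymm (hy i).2 hi
    have : m i = k i := by
      simp only [hm]
      rw [heq, mul_div_cancel_right₀ _ (hdpos i).ne', Nat.floor_natCast]
    exact ⟨this, by rw [this, heq]⟩
  have hmk : ∀ i ∈ s, m i + 1 ≤ k i := by
    intro i hi
    simp only [hs, Finset.mem_filter, Finset.mem_univ, true_and] at hi
    have h1 := lt_of_le_of_lt (hm1 i) hi
    have := lt_of_mul_lt_mul_right h1 (hdpos i).le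
    exact_mod_cast this
  set χ : ι → ℕ := fun i => if i ∈ s then 1 else 0 with hχ
  set k' : ι → ℕ := fun i => k i - m i - χ i with hk'
  have hk : ∀ i, k i = m i + (χ i + k' i) := by
    intro i
    by_cases hi : i ∈ s
    · have := hmk i hi
      simp only [hk', hχ, if_pos hi]
      omega
    · have := (hms i hi).1
      simp only [hk', hχ, if_neg hi]
      omega
  set u := ∑ i, m i • w i with hu
  set v := ∑ i ∈ s, w i with hv
  set u' := ∑ i, k' i • w i with hu'
  have hsumw : ∑ i, k i • w i = u + (v + u') := by
    simp only [hk, add_smul, Finset.sum_add_distrib]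
    simp [hχ, hv, hu, hu', ite_smul]
  have hsumd : ∑ i, k i * d i = ∑ i, m i * d i + (∑ i ∈ s, d i + ∑ i, k' i * d i) := by
    simp only [hk, add_mul, Finset.sum_add_distrib]
    simp [hχ]
  obtain ⟨y', hy'⟩ : ∃ y', u +ᵥ y' = y := ⟨-u +ᵥ y, vadd_neg_vadd u y⟩
  have hcy : ∀ i, c y i = m i * d i + c y' i := fun i => by
    rw [← hy', h.coord_vadd, Pi.add_apply, h.coord_sum]
  have hbox := h.box s y' (fun i => ⟨by linarith [hm1 i, hcy i], by
    have := hm2 i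
    rw [add_mul, one_mul] at this
    linarith [hcy i]⟩) (fun i hi => by linarith [(hms i hi).2, hcy i])
  -- For `≤`, travel from `x₀` by `u`, through the box by `v` via `y`, then by `u'`. For `≥`, use
  -- the lower bound supplied by the facet normal.
  apply le_antisymm
  · have h1 : D x₀ y ≤ ∑ i, m i * d i + D x₀ y' := by
      rw [← hy']
      refine (h.triangle _ (u +ᵥ x₀) _).trans (add_le_add (h.upper m) ?_)
      rw [h.vadd]
    have h2 : D y ((∑ i, k i • w i) +ᵥ x₀) ≤ D y' (v +ᵥ x₀) + ∑ i, k' i * d i := by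
      rw [← hy']
      refine (h.triangle _ (u +ᵥ (v +ᵥ x₀)) _).trans (add_le_add ?_ ?_)
      · rw [h.vadd]
      · rw [hsumw, add_vadd, add_vadd, h.vadd, h.vadd]
        exact h.upper k'
    rw [← hv] at hbox
    omega
  · exact (h.lower k).trans (h.triangle _ _ _)

theorem exists_bound (h : IsGeodesicCone D x₀ c ρ w d) (r : ι → ℝ) :
    ∃ k : ι → ℕ, ∀ i, r i ≤ k i * d i := by
  refine ⟨fun i => ⌈r i⌉₊, fun i => (Nat.le_ceil _).trans ?_⟩
  have : (1 : ℝ) ≤ d i := by exact_mod_cast h.pos i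
  exact le_mul_of_one_le_right (Nat.cast_nonneg _) this

theorem sum_add_single (k : ι → ℕ) (i : ι) : (open Classical in
    ∑ j, (k j + if j = i then 1 else 0) • w j) = w i + ∑ j, k j • w j := by
  classical
  simp [add_smul, Finset.sum_add_distrib, ite_smul, add_comm]

theorem sum_mul_add_single (k : ι → ℕ) (i : ι) : (open Classical in
    ∑ j, (k j + if j = i then 1 else 0) * d j) = d i + ∑ j, k j * d j := by
  classical
  simp [add_mul, Finset.sum_add_distrib, add_comm]

/-- Compare the geodesics through `y` and through `w i +ᵥ y` whose endpoints differ by `w i`: the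
remaining distances agree by translation invariance, and the totals differ by `d i`. -/
theorem dist_vadd_of_nonneg (h : IsGeodesicCone D x₀ c ρ w d) {y : V} (hy : ∀ i, 0 ≤ c y i)
    (i : ι) : D x₀ (w i +ᵥ y) = D x₀ y + d i := by
  classical
  obtain ⟨k, hk⟩ := h.exists_bound (c y)
  have h1 := h.geodesic (y := y) (k := k) fun j => ⟨hy j, hk j⟩
  have h2 := h.geodesic (y := w i +ᵥ y) (k := fun j => k j + if j = i then 1 else 0) (by
    intro j
    have hj := hy j
    have hkj := hk j
    have hd := h.pos i
    simp only [h.coord_vadd, Pi.add_apply, h.coord_generator]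
    split_ifs with hji
    · subst hji
      push_cast
      constructor
      · positivity
      · rw [add_mul, one_mul]; linarith
    · simp [hj, hkj])
  rw [sum_add_single, sum_mul_add_single, add_vadd, h.vadd] at h2
  omega

/-- A large translation brings `y` into the positive cone; symmetry of the distance then reads the
final stretch of the geodesic as the distance from `x₀` to `y`. Comparing `y` with `-w i +ᵥ y`
leaves the difference `d i`. -/
theorem dist_neg_vadd_of_nonpos (h : IsGeodesicCone D x₀ c ρ w d) {y : V} (hy : ∀ i, c y i ≤ 0)
    (i : ι) : D x₀ (-w i +ᵥ y) = D x₀ y + d i := by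
  classical
  have key : ∀ y : V, (∀ i, c y i ≤ 0) → ∀ k : ι → ℕ, (∀ i, -c y i ≤ k i * d i) →
      D x₀ ((∑ i, k i • w i) +ᵥ y) + D x₀ y = ∑ i, k i * d i := by
    intro y hy k hk
    have := h.geodesic (y := (∑ i, k i • w i) +ᵥ y) (k := k) fun j => by
      rw [h.coord_vadd, Pi.add_apply, h.coord_sum]
      constructor <;> linarith [hy j, hk j]
    rwa [h.vadd, h.comm y] at this
  obtain ⟨k, hk⟩ := h.exists_bound (-c y)
  have hcoord : ∀ j, c (-w i +ᵥ y) j = c y j - if j = i then (d i : ℝ) else 0 := fun j => by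
    rw [h.coord_vadd, map_neg, Pi.add_apply, Pi.neg_apply, h.coord_generator]
    ring
  have h1 := key y hy k hk
  have h2 := key (-w i +ᵥ y) (fun j => by
      rw [hcoord]
      have := hy j
      have hd : (0 : ℝ) ≤ d i := Nat.cast_nonneg _
      split_ifs <;> linarith) (fun j => k j + if j = i then 1 else 0) (fun j => by
      rw [hcoord]
      have := hk j
      simp only [Pi.neg_apply] at this
      split_ifs with hji
      · subst hji
        push_cast
        rw [add_mul, one_mul]
        linarith
      · simpa using this)
  rw [sum_add_single, sum_mul_add_single, add_comm (w i), add_vadd, vadd_neg_vadd] at h2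
  omega

/-- The second half of a geodesic to the far corner, translated and reversed, starts at `x₀`. This
is the source of the reflected numerators. -/
theorem dist_box (h : IsGeodesicCone D x₀ c ρ w d) {y : V}
    (hy : ∀ i, 0 ≤ c y i ∧ c y i ≤ d i) : D x₀ y + D x₀ (-(∑ i, w i) +ᵥ y) = ∑ i, d i := by
  have := h.geodesic (y := y) (k := 1) (by simpa using hy)
  simp only [Pi.one_apply, one_smul, one_mul] at this
  rw [← this, h.comm _ (-(∑ i, w i) +ᵥ y), ← h.vadd (∑ i, w i) _ x₀, vadd_neg_vadd]

end IsGeodesicCone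

/-- The vertices in a half-open cone, where `s` tells which bounding hyperplanes belong to it. -/
def halfOpenSet (c : V → ι → ℝ) (s : ι → Prop) : Set V :=
  {y | ∀ i, 0 < c y i ∨ (c y i = 0 ∧ s i)}

/-- The vertices in the fundamental box of a half-open cone. -/
def halfOpenBox (c : V → ι → ℝ) (d : ι → ℕ) (s : ι → Prop) : Set V :=
  {y | ∀ i, (0 < c y i ∨ (c y i = 0 ∧ s i)) ∧ (c y i < d i ∨ (c y i = d i ∧ ¬ s i))}

/-- Each factor telescopes along one generator and keeps the points that leave the half-open cone
when moved back by it. In each direction the far wall is kept exactly when the near one is not. -/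
theorem prod_mul_genFun {f : V → ℕ} (hf : ∀ m, {y | f y = m}.Finite) {c : V → ι → ℝ} {w : ι → L}
    {d : ι → ℕ} {s : ι → Prop}
    (hc : ∀ i y j, c (w i +ᵥ y) j = c y j + (open Classical in if j = i then (d i : ℝ) else 0))
    (hw : ∀ y ∈ halfOpenSet c s, ∀ i, f (w i +ᵥ y) = f y + d i) :
    (∏ i, (1 - PowerSeries.X ^ d i)) * genFun f (halfOpenSet c s) =
      genFun f (halfOpenBox c d s) := by
  classical
  set α : ι → ℝ → Prop := fun i r => 0 < r ∨ (r = 0 ∧ s i) with hα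
  have hmono : ∀ i r r', r ≤ r' → α i r → α i r' := by
    rintro i r r' hr (h | ⟨h, hs⟩)
    · exact Or.inl (h.trans_le hr)
    · rcases hr.lt_or_eq with h' | h'
      · exact Or.inl (h ▸ h')
      · exact Or.inr ⟨h'.symm.trans h, hs⟩
  have key : ∀ t : Finset ι, (∏ i ∈ t, (1 - PowerSeries.X ^ d i)) * genFun f (halfOpenSet c s) =
      genFun f {y | (∀ i, α i (c y i)) ∧ ∀ i ∈ t, ¬ α i (c y i - d i)} := by
    intro t
    induction t using Finset.induction_on with
    | empty => simp [halfOpenSet, hα]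
    | insert i t hit ih =>
      rw [Finset.prod_insert hit, mul_assoc, ih, one_sub_X_pow_mul_genFun hf (u := w i)]
      · congr 1
        ext y
        have hcn : ∀ j, c (-w i +ᵥ y) j = c y j - if j = i then (d i : ℝ) else 0 := by
          intro j
          have := hc i (-w i +ᵥ y) j
          rw [vadd_neg_vadd] at this
          linarith
        simp only [Set.mem_ofPred_eq, Finset.mem_insert, forall_eq_or_imp, hcn]
        constructor
        · rintro ⟨⟨h1, h2⟩, h3⟩
          refine ⟨h1, ?_, h2⟩
          intro h4
          apply h3
          constructor
          · intro j
            split_ifs with hji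
            · subst hji; exact h4
            · simpa using h1 j
          · intro j hj
            rw [if_neg (by rintro rfl; exact hit hj), sub_zero]
            exact h2 j hj
        · rintro ⟨h1, h2, h3⟩
          refine ⟨⟨h1, h3⟩, ?_⟩
          rintro ⟨h4, -⟩
          have := h4 i
          rw [if_pos rfl] at this
          exact h2 this
      · rintro y ⟨h1, h2⟩
        refine ⟨⟨fun j => ?_, fun j hj => ?_⟩, hw y h1 i⟩
        · refine hmono j _ _ ?_ (h1 j)
          rw [hc]
          split_ifs <;> simp
        · rw [hc, if_neg (by rintro rfl; exact hit hj), add_zero]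
          exact h2 j hj
  rw [key]
  congr 1
  ext y
  simp only [hα, halfOpenBox, Set.mem_ofPred_eq, Finset.mem_univ, forall_const]
  rw [← forall_and]
  refine forall_congr' fun i => and_congr_right fun _ => ?_
  rw [sub_pos, sub_eq_zero, not_or, not_lt, not_and]
  constructor
  · rintro ⟨h1, h2⟩
    rcases h1.lt_or_eq with h | h
    · exact Or.inl h
    · exact Or.inr ⟨h, h2 h⟩
  · rintro (h | ⟨h, hs⟩)
    · exact ⟨h.le, fun h' => absurd h' h.ne⟩
    · exact ⟨h.le, fun _ => hs⟩

theorem _root_.Polynomial.reflect_sum {R κ : Type*} [Semiring R] (N : ℕ) (t : Finset κ)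
    (f : κ → R[X]) : Polynomial.reflect N (∑ i ∈ t, f i) = ∑ i ∈ t, Polynomial.reflect N (f i) := by
  classical
  induction t using Finset.induction_on with
  | empty => simp
  | insert i t hit ih => rw [Finset.sum_insert hit, Finset.sum_insert hit, Polynomial.reflect_add, ih]

/-- The generating functions of the vertices in a half-open cone and in the opposite half-open
cone have the same denominator, and their numerators are reflections of each other. -/
theorem IsGeodesicCone.exists_numerator {D : V → V → ℕ} {x₀ : V} {c : V → ι → ℝ}
    {ρ : L →+ (ι → ℝ)} {w : ι → L} {d : ι → ℕ} (h : IsGeodesicCone D x₀ c ρ w d)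
    (hD : ∀ m, {y | D x₀ y ≤ m}.Finite) (s : ι → Prop) :
    ∃ N : ℚ[X], N.natDegree ≤ ∑ i, d i ∧
      (∏ i, (1 - PowerSeries.X ^ d i)) * genFun (D x₀) (halfOpenSet c s) = (N : ℚ⟦X⟧) ∧
      (∏ i, (1 - PowerSeries.X ^ d i)) * genFun (D x₀) (halfOpenSet (-c) fun i => ¬ s i) =
        (N.reflect (∑ i, d i) : ℚ⟦X⟧) := by
  classical
  have hf : ∀ m, {y | D x₀ y = m}.Finite := fun m => (hD m).subset fun y hy => le_of_eq hy
  have hbox : ∀ y ∈ halfOpenBox c d s, ∀ i, 0 ≤ c y i ∧ c y i ≤ d i := by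
    intro y hy i
    obtain ⟨h1, h2⟩ := hy i
    exact ⟨h1.elim le_of_lt fun h => h.1.ge, h2.elim le_of_lt fun h => h.1.le⟩
  have hB : (halfOpenBox c d s).Finite := (hD (∑ i, d i)).subset fun y hy => by
    have := h.dist_box (hbox y hy)
    simp only [Set.mem_ofPred_eq]
    omega
  -- The translation changes `c` to `c - d`, so `-c` becomes `d - c`: near and far walls are
  -- exchanged, in agreement with `¬ s`.
  have himg : halfOpenBox (-c) d (fun i => ¬ s i) = (-(∑ i, w i) +ᵥ ·) '' halfOpenBox c d s := by
    have hcoord : ∀ y i, c (-(∑ i, w i) +ᵥ y) i = c y i - d i := fun y i => by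
      have := h.coord_sum (fun _ => 1) i
      simp only [one_smul, Nat.cast_one, one_mul] at this
      rw [h.coord_vadd, map_neg, Pi.add_apply, Pi.neg_apply, this]
      ring
    have hiff : ∀ y, -(∑ i, w i) +ᵥ y ∈ halfOpenBox (-c) d (fun i => ¬ s i) ↔
        y ∈ halfOpenBox c d s := by
      intro y
      refine forall_congr' fun i => ?_
      simp only [Pi.neg_apply, hcoord, neg_sub, sub_pos, not_not, sub_eq_zero, sub_lt_self_iff,
        sub_eq_self, @eq_comm ℝ (d i)]
      exact and_comm
    ext y
    constructor
    · intro hy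
      refine ⟨(∑ i, w i) +ᵥ y, (hiff _).1 (by simpa using hy), by simp⟩
    · rintro ⟨z, hz, rfl⟩
      exact (hiff z).2 hz
  have hB' : (halfOpenBox (-c) d fun i => ¬ s i).Finite := by
    rw [himg]; exact hB.image _
  refine ⟨∑ y ∈ hB.toFinset, Polynomial.X ^ D x₀ y, ?_, ?_, ?_⟩
  · refine Polynomial.natDegree_sum_le_of_forall_le _ _ fun y hy => ?_
    have := h.dist_box (hbox y (hB.mem_toFinset.1 hy))
    rw [Polynomial.natDegree_X_pow]
    omega
  · rw [← genFun_eq_sum hB]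
    refine prod_mul_genFun hf (fun i y j => ?_) fun y hy i => h.dist_vadd_of_nonneg (fun j => ?_) i
    · rw [h.coord_vadd, Pi.add_apply, h.coord_generator, add_comm]
    · exact (hy j).elim le_of_lt fun h => h.1.ge
  · rw [prod_mul_genFun hf (w := fun i => -w i), genFun_eq_sum hB', Polynomial.reflect_sum]
    · congr 1
      have : hB'.toFinset = hB.toFinset.image (-(∑ i, w i) +ᵥ ·) := by
        ext y
        simp [himg]
      rw [this, Finset.sum_image (fun a _ b _ hab => AddAction.injective _ hab)]
      refine Finset.sum_congr rfl fun y hy => ?_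
      have := h.dist_box (hbox y (hB.mem_toFinset.1 hy))
      rw [Polynomial.reflect_monomial, Polynomial.revAt_le (by omega)]
      congr 1
      dsimp only
      omega
    · intro i y j
      rw [Pi.neg_apply, Pi.neg_apply, Pi.neg_apply, Pi.neg_apply, h.coord_vadd, map_neg,
        Pi.add_apply, Pi.neg_apply, h.coord_generator]
      ring
    · intro y hy i
      refine h.dist_neg_vadd_of_nonpos (fun j => ?_) i
      rcases hy j with h1 | h1
      · exact (neg_pos.1 h1).le
      · exact (neg_eq_zero.1 h1.1).le

end Cone

/-! ### Rational functions and the substitution `t ↦ 1 / t` -/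

section RationalFunctions

theorem isExpansion_algebraMap (p : ℚ[X]) :
    IsExpansion (algebraMap ℚ[X] (RatFunc ℚ) p) (p : ℚ⟦X⟧) :=
  (RatFunc.coe_coe p).symm

theorem IsExpansion.sum {κ : Type*} {s : Finset κ} {R : κ → RatFunc ℚ} {F : κ → ℚ⟦X⟧}
    (h : ∀ k ∈ s, IsExpansion (R k) (F k)) : IsExpansion (∑ k ∈ s, R k) (∑ k ∈ s, F k) := by
  unfold IsExpansion at *
  rw [map_sum, map_sum]
  exact Finset.sum_congr rfl h

theorem isExpansion_div_iff {p q : ℚ[X]} (hq : q ≠ 0) {G : ℚ⟦X⟧} :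
    IsExpansion (algebraMap ℚ[X] (RatFunc ℚ) p / algebraMap ℚ[X] (RatFunc ℚ) q) G ↔
      (q : ℚ⟦X⟧) * G = p := by
  have hq' : (HahnSeries.ofPowerSeries ℤ ℚ) (q : ℚ⟦X⟧) ≠ 0 := by
    rw [Ne, map_eq_zero_iff _ HahnSeries.ofPowerSeries_injective]
    exact_mod_cast hq
  unfold IsExpansion
  have hp := isExpansion_algebraMap p
  have hqe := isExpansion_algebraMap q
  unfold IsExpansion at hp hqe
  rw [map_div₀, hp, hqe, div_eq_iff hq', ← map_mul, HahnSeries.ofPowerSeries_injective.eq_iff,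
    mul_comm G, eq_comm]

theorem IsExpansion.unique {R S : RatFunc ℚ} {G : ℚ⟦X⟧} (h : IsExpansion R G)
    (h' : IsExpansion S G) : R = S := by
  unfold IsExpansion at *
  exact RingHom.injective _ (h.trans h'.symm)

/-- The substitution `t ↦ 1 / t` on polynomials. -/
def evalInv : ℚ[X] →+* RatFunc ℚ := Polynomial.eval₂RingHom RatFunc.C (RatFunc.X)⁻¹

theorem evalInv_mul_X_pow {p : ℚ[X]} {N : ℕ} (hp : p.natDegree ≤ N) :
    evalInv p * RatFunc.X ^ N = algebraMap ℚ[X] (RatFunc ℚ) (p.reflect N) := by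
  let _ : Invertible (RatFunc.X : RatFunc ℚ) := invertibleOfNonzero RatFunc.X_ne_zero
  have h := Polynomial.eval₂_reflect_mul_pow (RatFunc.C : ℚ →+* RatFunc ℚ) RatFunc.X N
    (p.reflect N) (by simpa [hp] using Polynomial.natDegree_reflect_le (N := N) (p := p))
  rw [Polynomial.reflect_reflect, invOf_eq_inv] at h
  rw [evalInv, Polynomial.coe_eval₂RingHom, h]
  rw [← RatFunc.algebraMap_X, ← RatFunc.algebraMap_comp_C, ← Polynomial.hom_eval₂,
    Polynomial.eval₂_C_X]

/-- Needed to extend the substitution to fractions: no nonzero denominator is sent to zero. -/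
theorem evalInv_injective : Function.Injective evalInv := by
  rw [injective_iff_map_eq_zero]
  intro p hp
  have h := evalInv_mul_X_pow (le_refl p.natDegree)
  rw [hp, zero_mul, eq_comm, map_eq_zero_iff _ (RatFunc.algebraMap_injective ℚ)] at h
  simpa using h

/-- The substitution `t ↦ 1 / t` as a ring homomorphism. -/
def atInvHom : RatFunc ℚ →+* RatFunc ℚ :=
  RatFunc.liftRingHom evalInv (nonZeroDivisors_le_comap_nonZeroDivisors_of_injective _
    evalInv_injective)

/-- Evaluation of rational functions is multiplicative only where denominators survive; at `1/t`
they all do, so a ring homomorphism can replace it. -/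
theorem atInv_eq (R : RatFunc ℚ) : atInv R = atInvHom R := by
  rw [atInvHom, RatFunc.liftRingHom_apply]
  rfl

theorem atInvHom_algebraMap (p : ℚ[X]) :
    atInvHom (algebraMap ℚ[X] (RatFunc ℚ) p) = evalInv p :=
  RatFunc.liftRingHom_algebraMap _ _ p

theorem evalInv_one_sub_X_pow (e : ℕ) : evalInv (1 - Polynomial.X ^ e) * RatFunc.X ^ e =
    -algebraMap ℚ[X] (RatFunc ℚ) (1 - Polynomial.X ^ e) := by
  have hX := RatFunc.X_ne_zero (K := ℚ)
  simp only [map_sub, map_one, map_pow, RatFunc.algebraMap_X]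
  rw [show evalInv Polynomial.X = (RatFunc.X)⁻¹ by simp [evalInv], sub_mul, ← mul_pow,
    inv_mul_cancel₀ hX]
  ring

theorem one_sub_X_pow_ne_zero {e : ℕ} (he : 0 < e) : (1 - Polynomial.X ^ e : ℚ[X]) ≠ 0 := by
  intro h
  have := congrArg (Polynomial.eval 0) h
  simp [he.ne'] at this

theorem natDegree_one_sub_X_pow (e : ℕ) : (1 - Polynomial.X ^ e : ℚ[X]).natDegree = e := by
  rw [← Polynomial.natDegree_neg, neg_sub, ← Polynomial.C_1, Polynomial.natDegree_X_pow_sub_C]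

variable {ι : Type*} [Fintype ι]

/-- The denominator `∏ (1 - t ^ d_i)`. -/
def denominator (d : ι → ℕ) : ℚ[X] := ∏ i, (1 - Polynomial.X ^ d i)

theorem denominator_ne_zero {d : ι → ℕ} (hd : ∀ i, 0 < d i) : denominator d ≠ 0 :=
  Finset.prod_ne_zero_iff.2 fun i _ => one_sub_X_pow_ne_zero (hd i)

theorem natDegree_denominator {d : ι → ℕ} (hd : ∀ i, 0 < d i) :
    (denominator d).natDegree = ∑ i, d i := by
  rw [denominator, Polynomial.natDegree_prod _ _ fun i _ => one_sub_X_pow_ne_zero (hd i)]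
  simp only [natDegree_one_sub_X_pow]

theorem coe_denominator (d : ι → ℕ) :
    (denominator d : ℚ⟦X⟧) = ∏ i, (1 - PowerSeries.X ^ d i) := by
  rw [denominator, ← Polynomial.coeToPowerSeries.ringHom_apply, map_prod]
  simp

/-- Each factor contributes one sign through `1 - t^{-e} = -t^{-e}(1 - t^e)`; this is the origin of
`(-1)^n` in the reciprocity law. -/
theorem evalInv_denominator (d : ι → ℕ) : evalInv (denominator d) * RatFunc.X ^ (∑ i, d i) =
    (-1) ^ Fintype.card ι * algebraMap ℚ[X] (RatFunc ℚ) (denominator d) := by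
  rw [denominator, map_prod, map_prod, ← Finset.prod_pow_eq_pow_sum, ← Finset.prod_mul_distrib]
  simp only [evalInv_one_sub_X_pow]
  rw [Finset.prod_neg, Finset.card_univ]

theorem atInvHom_div_denominator {d : ι → ℕ} (hd : ∀ i, 0 < d i) {N : ℚ[X]}
    (hN : N.natDegree ≤ ∑ i, d i) :
    atInvHom (algebraMap ℚ[X] (RatFunc ℚ) N / algebraMap ℚ[X] (RatFunc ℚ) (denominator d)) =
      (-1) ^ Fintype.card ι * (algebraMap ℚ[X] (RatFunc ℚ) (N.reflect (∑ i, d i)) /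
        algebraMap ℚ[X] (RatFunc ℚ) (denominator d)) := by
  have hX : (RatFunc.X : RatFunc ℚ) ^ (∑ i, d i) ≠ 0 := pow_ne_zero _ RatFunc.X_ne_zero
  have hP : algebraMap ℚ[X] (RatFunc ℚ) (denominator d) ≠ 0 := by
    rw [Ne, map_eq_zero_iff _ (RatFunc.algebraMap_injective ℚ)]
    exact denominator_ne_zero hd
  have hsq : ((-1 : RatFunc ℚ) ^ Fintype.card ι) * (-1) ^ Fintype.card ι = 1 := by
    rw [← mul_pow]; simp
  rw [map_div₀, atInvHom_algebraMap, atInvHom_algebraMap, ← mul_div_mul_right _ _ hX,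
    evalInv_mul_X_pow hN, evalInv_denominator, div_eq_iff (mul_ne_zero (by simp) hP)]
  field_simp
  rw [sq, hsq, mul_one]

end RationalFunctions

/-! ### Decompositions of a series into reciprocal pieces -/

/-- The series `G` has two decompositions into rational pieces with denominators
`∏ (1 - t ^ d_i)`, such that the numerators are reflections of each other. -/
structure IsReciprocal {κ : Type*} [Fintype κ] {ι : κ → Type*} [∀ k, Fintype (ι k)]
    (G : ℚ⟦X⟧) (n : ℕ) (d : ∀ k, ι k → ℕ) (N : κ → ℚ[X]) (g g' : κ → ℚ⟦X⟧) : Prop where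
  pos : ∀ k i, 0 < d k i
  card : ∀ k, Fintype.card (ι k) = n
  natDegree_le : ∀ k, (N k).natDegree ≤ ∑ i, d k i
  sum : G = ∑ k, g k
  sum' : G = ∑ k, g' k
  mul : ∀ k, (denominator (d k) : ℚ⟦X⟧) * g k = N k
  mul' : ∀ k, (denominator (d k) : ℚ⟦X⟧) * g' k = ((N k).reflect (∑ i, d k i) : ℚ[X])

namespace IsReciprocal

variable {κ : Type*} [Fintype κ] {ι : κ → Type*} [∀ k, Fintype (ι k)]
    {G : ℚ⟦X⟧} {n : ℕ} {d : ∀ k, ι k → ℕ} {N : κ → ℚ[X]} {g g' : κ → ℚ⟦X⟧}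

/-- At `1/t` each piece of the first decomposition becomes `(-1)^n` times the matching piece of the
second, and both decompositions sum to the same rational function. -/
theorem exists_ratFunc (h : IsReciprocal G n d N g g') :
    ∃ R : RatFunc ℚ, IsExpansion R G ∧ atInv R = (-1) ^ n * R := by
  set f : κ → RatFunc ℚ := fun k => algebraMap ℚ[X] (RatFunc ℚ) (N k) /
    algebraMap ℚ[X] (RatFunc ℚ) (denominator (d k)) with hf
  set f' : κ → RatFunc ℚ := fun k => algebraMap ℚ[X] (RatFunc ℚ) ((N k).reflect (∑ i, d k i)) /
    algebraMap ℚ[X] (RatFunc ℚ) (denominator (d k)) with hf'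
  have h1 : IsExpansion (∑ k, f k) G := by
    rw [h.sum]
    exact IsExpansion.sum fun k _ =>
      (isExpansion_div_iff (denominator_ne_zero (h.pos k))).2 (h.mul k)
  have h2 : IsExpansion (∑ k, f' k) G := by
    rw [h.sum']
    exact IsExpansion.sum fun k _ =>
      (isExpansion_div_iff (denominator_ne_zero (h.pos k))).2 (h.mul' k)
  refine ⟨∑ k, f k, h1, ?_⟩
  rw [atInv_eq, map_sum]
  conv_rhs => rw [h1.unique h2, Finset.mul_sum]
  refine Finset.sum_congr rfl fun k _ => ?_
  rw [hf, hf']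
  simp only
  rw [atInvHom_div_denominator (h.pos k) (h.natDegree_le k), h.card]

/-- No piece has a numerator of larger degree than its denominator, and this property survives
passing to a common denominator and summing. -/
theorem exists_common_numerator (h : IsReciprocal G n d N g g') {Q : ℚ[X]}
    (hQ : ∀ k, denominator (d k) ∣ Q) : ∃ A : ℚ[X], A.degree ≤ Q.degree ∧ (Q : ℚ⟦X⟧) * G = A := by
  choose M hM using hQ
  refine ⟨∑ k, M k * N k, ?_, ?_⟩
  · refine (Polynomial.degree_sum_le _ _).trans (Finset.sup_le fun k _ => ?_)
    rw [hM k, mul_comm (denominator _), Polynomial.degree_mul, Polynomial.degree_mul]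
    refine add_le_add le_rfl ?_
    rw [Polynomial.degree_eq_natDegree (denominator_ne_zero (h.pos k)),
      natDegree_denominator (h.pos k)]
    exact Polynomial.degree_le_of_natDegree_le (h.natDegree_le k)
  · rw [h.sum, Finset.mul_sum, ← Polynomial.coeToPowerSeries.ringHom_apply (φ := ∑ k, M k * N k),
      map_sum]
    refine Finset.sum_congr rfl fun k _ => ?_
    rw [map_mul, Polynomial.coeToPowerSeries.ringHom_apply,
      Polynomial.coeToPowerSeries.ringHom_apply, ← h.mul k]
    conv_lhs => rw [hM k, Polynomial.coe_mul]
    ring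

/-- A least common multiple is a generator of the intersection of the principal ideals; it is
nonzero because it divides the product of all denominators. -/
theorem exists_lcm (h : IsReciprocal G n d N g g') {S : Set ℚ[X]}
    (hS : S = Set.range fun k => denominator (d k)) :
    ∃ Q₁ Q₂ : ℚ[X], IsLCM S Q₂ ∧ Q₁.degree ≤ Q₂.degree ∧
      IsExpansion (algebraMap ℚ[X] (RatFunc ℚ) Q₁ / algebraMap ℚ[X] (RatFunc ℚ) Q₂) G := by
  set I : Ideal ℚ[X] := ⨅ f ∈ S, Ideal.span {f} with hI
  have hmem : ∀ R : ℚ[X], R ∈ I ↔ ∀ f ∈ S, f ∣ R := by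
    intro R
    simp [hI, Submodule.mem_iInf, Ideal.mem_span_singleton]
  set Q₂ := Submodule.IsPrincipal.generator I with hQ₂
  have hgen := (hmem Q₂).1 (Submodule.IsPrincipal.generator_mem I)
  have hlcm : IsLCM S Q₂ :=
    ⟨hgen, fun R hR => (Submodule.IsPrincipal.mem_iff_generator_dvd I).1 ((hmem R).2 hR)⟩
  have hne : Q₂ ≠ 0 := by
    intro h0
    have hprod : Q₂ ∣ ∏ k, denominator (d k) := by
      refine hlcm.2 _ fun f hf => ?_
      rw [hS] at hf
      obtain ⟨k, rfl⟩ := hf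
      exact Finset.dvd_prod_of_mem _ (Finset.mem_univ k)
    rw [h0, zero_dvd_iff] at hprod
    exact Finset.prod_ne_zero_iff.2 (fun k _ => denominator_ne_zero (h.pos k)) hprod
  obtain ⟨Q₁, hdeg, hmul⟩ := h.exists_common_numerator (Q := Q₂)
    (fun k => hgen _ (by rw [hS]; exact ⟨k, rfl⟩))
  exact ⟨Q₁, Q₂, hlcm, hdeg, (isExpansion_div_iff hne).2 hmul⟩

theorem exists_ratFunc_cumulative (h : IsReciprocal G n d N g g') {B : ℚ⟦X⟧}
    (hB : (1 - PowerSeries.X) * B = G) :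
    ∃ Rb Rs : RatFunc ℚ, IsExpansion Rb B ∧ IsExpansion Rs G ∧
      atInv Rb = (-1) ^ (n + 1) * RatFunc.X * Rb ∧ atInv Rs = (-1) ^ n * Rs := by
  obtain ⟨Rs, hRs, hinv⟩ := h.exists_ratFunc
  have hX := RatFunc.X_ne_zero (K := ℚ)
  set q := algebraMap ℚ[X] (RatFunc ℚ) (1 - Polynomial.X ^ 1) with hq
  have hq0 : q ≠ 0 := by
    rw [hq, Ne, map_eq_zero_iff _ (RatFunc.algebraMap_injective ℚ)]
    exact one_sub_X_pow_ne_zero one_pos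
  refine ⟨Rs / q, Rs, ?_, hRs, ?_, hinv⟩
  · have h1 := isExpansion_algebraMap (1 - Polynomial.X ^ 1)
    have h2 : (((1 - Polynomial.X ^ 1 : ℚ[X]) : ℚ⟦X⟧)) = 1 - PowerSeries.X := by simp
    have hne : HahnSeries.ofPowerSeries ℤ ℚ (1 - PowerSeries.X) ≠ 0 := by
      rw [← h2, Ne, map_eq_zero_iff _ HahnSeries.ofPowerSeries_injective]
      exact_mod_cast one_sub_X_pow_ne_zero one_pos
    rw [h2, ← hq] at h1
    unfold IsExpansion at *
    rw [map_div₀, hRs, h1, div_eq_iff hne, ← hB, map_mul, mul_comm]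
  -- From `1 - 1/t = -(1 - t)/t`: dividing by it yields the extra factor `-t` for the cumulative
  -- series.
  · have h3 : evalInv (1 - Polynomial.X ^ 1) = -q / RatFunc.X := by
      rw [eq_div_iff hX, ← evalInv_one_sub_X_pow, pow_one RatFunc.X]
    rw [atInv_eq, map_div₀, ← atInv_eq, hinv, hq, atInvHom_algebraMap, h3, ← hq, pow_succ]
    field_simp

end IsReciprocal

/-! ### Quasi-polynomials -/

section QuasiPolynomials

theorem isQuasiPolynomial_iff {f : ℤ → ℂ} : IsQuasiPolynomial f ↔
    ∃ N : ℕ, 0 < N ∧ ∀ r : ℤ, ∃ q : ℂ[X], ∀ m : ℤ, m ≡ r [ZMOD N] → f m = q.eval (m : ℂ) := by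
  constructor
  · rintro ⟨N, hN, Q, hQ⟩
    refine ⟨N, hN, fun r => ?_⟩
    have hN' : (N : ℤ) ≠ 0 := by exact_mod_cast hN.ne'
    have h0 := Int.emod_nonneg r hN'
    have h1 := Int.emod_lt_of_pos r (by exact_mod_cast hN : (0 : ℤ) < N)
    refine ⟨Q ⟨(r % N).toNat, by omega⟩, fun m hm => hQ _ m ?_⟩
    simp only [Int.toNat_of_nonneg h0]
    exact hm.trans (Int.mod_modEq r N).symm
  · rintro ⟨N, hN, h⟩
    choose Q hQ using h
    exact ⟨N, hN, fun i => Q i, fun i m hm => hQ i m hm⟩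

theorem IsQuasiPolynomial.sub {f g : ℤ → ℂ} (hf : IsQuasiPolynomial f)
    (hg : IsQuasiPolynomial g) : IsQuasiPolynomial (f - g) := by
  rw [isQuasiPolynomial_iff] at *
  obtain ⟨N, hN, hf⟩ := hf
  obtain ⟨N', hN', hg⟩ := hg
  refine ⟨N * N', Nat.mul_pos hN hN', fun r => ?_⟩
  obtain ⟨p, hp⟩ := hf r
  obtain ⟨q, hq⟩ := hg r
  refine ⟨p - q, fun m hm => ?_⟩
  push_cast at hm
  rw [Pi.sub_apply, hp m (Int.ModEq.of_mul_right _ hm), hq m (Int.ModEq.of_mul_left _ hm),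
    Polynomial.eval_sub]

theorem IsQuasiPolynomial.shift {f : ℤ → ℂ} (hf : IsQuasiPolynomial f) :
    IsQuasiPolynomial fun i => f (i - 1) := by
  rw [isQuasiPolynomial_iff] at *
  obtain ⟨N, hN, hf⟩ := hf
  refine ⟨N, hN, fun r => ?_⟩
  obtain ⟨p, hp⟩ := hf (r - 1)
  refine ⟨p.comp (Polynomial.X - 1), fun m hm => ?_⟩
  rw [hp (m - 1) (hm.sub_right 1)]
  simp

/-- In each residue class the polynomial has infinitely many roots. Eventual agreement thus
determines a quasi-polynomial at negative integers as well. -/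
theorem IsQuasiPolynomial.eq_zero {f : ℤ → ℂ} (hf : IsQuasiPolynomial f) {M : ℕ}
    (h : ∀ i : ℕ, M < i → f i = 0) : f = 0 := by
  rw [isQuasiPolynomial_iff] at hf
  obtain ⟨N, hN, hf⟩ := hf
  ext r
  obtain ⟨p, hp⟩ := hf r
  have hp0 : p = 0 := by
    refine Polynomial.eq_zero_of_infinite_isRoot p ?_
    have hinj : Function.Injective fun t : ℕ => ((r + N * (r.natAbs + M + 1 + t : ℕ) : ℤ) : ℂ) := by
      intro a b hab
      have h1 := Int.cast_injective hab
      have hN' : (N : ℤ) ≠ 0 := by exact_mod_cast hN.ne'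
      have h2 := mul_left_cancel₀ hN' (add_left_cancel h1)
      omega
    refine (Set.infinite_range_of_injective hinj).mono ?_
    rintro _ ⟨t, rfl⟩
    have hle : ((r.natAbs + M + 1 + t : ℕ) : ℤ) ≤ N * (r.natAbs + M + 1 + t : ℕ) :=
      le_mul_of_one_le_left (by positivity) (by exact_mod_cast hN)
    have hlt : (M : ℤ) < r + N * (r.natAbs + M + 1 + t : ℕ) := by omega
    have hmod : r + N * (r.natAbs + M + 1 + t : ℕ) ≡ r [ZMOD N] := by
      simp [Int.ModEq]
    have h1 := hp _ hmod
    obtain ⟨i, hi⟩ := Int.eq_ofNat_of_zero_le (show 0 ≤ r + N * (r.natAbs + M + 1 + t : ℕ) by omega)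
    have h2 := h i (by omega)
    simp only [Set.mem_ofPred_eq, Polynomial.IsRoot]
    rw [← h1, hi]
    exact h2
  rw [hp r rfl, hp0]
  simp

theorem IsQuasiPolynomialOf.unique {f f' : ℤ → ℂ} {g : ℕ → ℕ} (hf : IsQuasiPolynomialOf f g)
    (hf' : IsQuasiPolynomialOf f' g) : f = f' := by
  obtain ⟨h, M, hM⟩ := hf
  obtain ⟨h', M', hM'⟩ := hf'
  refine sub_eq_zero.1 ((h.sub h').eq_zero (M := max M M') fun i hi => ?_)
  rw [Pi.sub_apply, ← hM i (lt_of_le_of_lt (le_max_left _ _) hi),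
    ← hM' i (lt_of_le_of_lt (le_max_right _ _) hi), sub_self]

/-- The polynomial `binom(x + n, n)`. -/
def binomialPolynomial (n : ℕ) : ℂ[X] :=
  Polynomial.C ((n.factorial : ℂ)⁻¹) * ∏ r ∈ Finset.range n, (Polynomial.X + ((r + 1 : ℕ) : ℂ[X]))

theorem eval_binomialPolynomial (n : ℕ) (x : ℂ) : (binomialPolynomial n).eval x =
    (n.factorial : ℂ)⁻¹ * ∏ r ∈ Finset.range n, (x + ((r + 1 : ℕ) : ℂ)) := by
  rw [binomialPolynomial, Polynomial.eval_mul, Polynomial.eval_C, Polynomial.eval_prod]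
  simp only [Polynomial.eval_add, Polynomial.eval_X, Polynomial.eval_natCast]

theorem eval_binomialPolynomial_natCast (n k : ℕ) :
    (binomialPolynomial n).eval (k : ℂ) = ((k + n).choose n : ℂ) := by
  have h := Nat.ascFactorial_eq_factorial_mul_choose k n
  rw [Nat.ascFactorial_eq_prod_range] at h
  have hn : (n.factorial : ℂ) ≠ 0 := by exact_mod_cast n.factorial_ne_zero
  rw [eval_binomialPolynomial, inv_mul_eq_iff_eq_mul₀ hn]
  norm_cast
  rw [← h]
  exact Finset.prod_congr rfl fun r _ => by ring

theorem eval_binomialPolynomial_neg {n r : ℕ} (hr : 0 < r) (hrn : r ≤ n) :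
    (binomialPolynomial n).eval (-(r : ℂ)) = 0 := by
  rw [eval_binomialPolynomial, Finset.prod_eq_zero (i := r - 1) (Finset.mem_range.2 (by omega)),
    mul_zero]
  rw [Nat.sub_add_cancel hr]
  ring

theorem eval_binomialPolynomial_reflect (n : ℕ) (x : ℂ) :
    (binomialPolynomial n).eval (-x - (n + 1)) = (-1) ^ n * (binomialPolynomial n).eval x := by
  rw [eval_binomialPolynomial, eval_binomialPolynomial, ← Finset.prod_range_reflect]
  have : ∏ j ∈ Finset.range n, (-x - (n + 1) + ((n - 1 - j + 1 : ℕ) : ℂ)) =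
      ∏ j ∈ Finset.range n, -(x + ((j + 1 : ℕ) : ℂ)) := by
    refine Finset.prod_congr rfl fun j hj => ?_
    have hj := Finset.mem_range.1 hj
    have : ((n - 1 - j + 1 : ℕ) : ℂ) = n - j := by
      rw [show n - 1 - j + 1 = n - j by omega, Nat.cast_sub hj.le]
    rw [this]
    push_cast
    ring
  rw [this, Finset.prod_neg, Finset.card_range]
  ring

/-- The expansion of `1 / (1 - t ^ N) ^ (n + 1)`. -/
def binomialSeries (N n : ℕ) : ℚ⟦X⟧ :=
  PowerSeries.mk fun i => if N ∣ i then ((i / N + n).choose n : ℚ) else 0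

theorem one_sub_X_pow_mul_binomialSeries_zero {N : ℕ} (hN : 0 < N) :
    (1 - PowerSeries.X ^ N) * binomialSeries N 0 = 1 := by
  ext i
  rw [sub_mul, one_mul, map_sub, PowerSeries.coeff_X_pow_mul', PowerSeries.coeff_one]
  simp only [binomialSeries, PowerSeries.coeff_mk, Nat.choose_zero_right, Nat.cast_one]
  by_cases hi : i = 0
  · subst hi
    simp [hN.ne']
  · rw [if_neg hi]
    by_cases hNi : N ≤ i
    · rw [if_pos hNi]
      have : N ∣ i - N ↔ N ∣ i := by
        rw [← Nat.dvd_add_self_right, Nat.sub_add_cancel hNi]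
      simp [this]
    · rw [if_neg hNi, if_neg, sub_zero]
      exact fun h => hNi (Nat.le_of_dvd (by omega) h)

theorem one_sub_X_pow_mul_binomialSeries_succ {N : ℕ} (hN : 0 < N) (n : ℕ) :
    (1 - PowerSeries.X ^ N) * binomialSeries N (n + 1) = binomialSeries N n := by
  ext i
  rw [sub_mul, one_mul, map_sub, PowerSeries.coeff_X_pow_mul']
  simp only [binomialSeries, PowerSeries.coeff_mk]
  by_cases hi : N ∣ i
  · obtain ⟨k, rfl⟩ := hi
    rw [if_pos (dvd_mul_right _ _), if_pos (dvd_mul_right _ _), Nat.mul_div_cancel_left _ hN]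
    cases k with
    | zero => simp [hN.ne']
    | succ k =>
      rw [if_pos (Nat.le_mul_of_pos_right _ (Nat.succ_pos k)),
        show N * (k + 1) - N = N * k by rw [mul_add, mul_one, Nat.add_sub_cancel],
        if_pos (dvd_mul_right _ _), Nat.mul_div_cancel_left _ hN,
        show k + 1 + (n + 1) = (k + 1 + n) + 1 by ring, Nat.choose_succ_succ,
        show k + (n + 1) = k + 1 + n by ring]
      push_cast
      ring
  · rw [if_neg hi, if_neg hi]
    split_ifs with h1 h2
    · exact absurd (by simpa [Nat.sub_add_cancel h1] using h2.add (dvd_refl N)) hi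
    · simp
    · simp

theorem one_sub_X_pow_pow_mul_binomialSeries {N : ℕ} (hN : 0 < N) (n : ℕ) :
    (1 - PowerSeries.X ^ N) ^ (n + 1) * binomialSeries N n = 1 := by
  induction n with
  | zero => rw [zero_add, pow_one, one_sub_X_pow_mul_binomialSeries_zero hN]
  | succ n ih => rw [pow_succ, mul_assoc, one_sub_X_pow_mul_binomialSeries_succ hN, ih]

/-- The quasi-polynomial of the coefficients of `A(t) / (1 - t ^ N) ^ (n + 1)`. -/
def coeffQuasiPolynomial (N n : ℕ) (A : ℚ[X]) (i : ℤ) : ℂ :=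
  ∑ j ∈ Finset.range (N * (n + 1)), if (N : ℤ) ∣ i - j then
    (A.coeff j : ℂ) * (binomialPolynomial n).eval (((i - j : ℤ) : ℂ) / N) else 0

theorem isQuasiPolynomial_coeffQuasiPolynomial {N : ℕ} (hN : 0 < N) (n : ℕ) (A : ℚ[X]) :
    IsQuasiPolynomial (coeffQuasiPolynomial N n A) := by
  classical
  rw [isQuasiPolynomial_iff]
  refine ⟨N, hN, fun r => ⟨∑ j ∈ Finset.range (N * (n + 1)), if (N : ℤ) ∣ r - j then
    Polynomial.C (A.coeff j : ℂ) * (binomialPolynomial n).comp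
      ((Polynomial.X - Polynomial.C (j : ℂ)) * Polynomial.C (N : ℂ)⁻¹) else 0, fun m hm => ?_⟩⟩
  rw [Polynomial.eval_finsetSum, coeffQuasiPolynomial]
  refine Finset.sum_congr rfl fun j _ => ?_
  have hiff : (N : ℤ) ∣ m - j ↔ (N : ℤ) ∣ r - j := by
    have := (hm.sub_right (j : ℤ)).dvd_iff
    exact this
  simp only [hiff]
  split_ifs
  · simp [div_eq_mul_inv]
  · simp

/-- The true coefficient sums over `j ≤ i` only. For the additional `j < N(n+1)` in the formula, `(i
- j)/N` is one of the roots `-1, …, -n` of the binomial polynomial whenever it is an integer. This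
is why the degree bound on `A` gives agreement from `i = 0` on. -/
theorem coeff_eq_coeffQuasiPolynomial {N : ℕ} (hN : 0 < N) {n : ℕ} {A : ℚ[X]}
    (hA : A.degree < (N * (n + 1) : ℕ)) {B : ℚ⟦X⟧}
    (hB : (1 - PowerSeries.X ^ N) ^ (n + 1) * B = (A : ℚ⟦X⟧)) (i : ℕ) :
    ((PowerSeries.coeff i B : ℚ) : ℂ) = coeffQuasiPolynomial N n A i := by
  have hBA : B = A * binomialSeries N n := by
    rw [← hB, mul_right_comm, one_sub_X_pow_pow_mul_binomialSeries hN, one_mul]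
  have hN' : (N : ℂ) ≠ 0 := by exact_mod_cast hN.ne'
  have hlhs : ((PowerSeries.coeff i B : ℚ) : ℂ) = ∑ j ∈ Finset.range (i + 1),
      if (N : ℤ) ∣ (i : ℤ) - j then
        (A.coeff j : ℂ) * (binomialPolynomial n).eval ((((i : ℤ) - j : ℤ) : ℂ) / N) else 0 := by
    rw [hBA, PowerSeries.coeff_mul, Finset.Nat.sum_antidiagonal_eq_sum_range_succ_mk]
    push_cast
    refine Finset.sum_congr rfl fun j hj => ?_
    have hj : j ≤ i := Nat.lt_succ_iff.1 (Finset.mem_range.1 hj)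
    rw [binomialSeries, PowerSeries.coeff_mk]
    have hiff : (N : ℤ) ∣ (i : ℤ) - j ↔ N ∣ i - j := by
      rw [← Nat.cast_sub hj, Int.natCast_dvd_natCast]
    simp only [hiff]
    split_ifs with hd
    · obtain ⟨k, hk⟩ := hd
      rw [hk, Nat.mul_div_cancel_left _ hN]
      have : ((i : ℂ) - j) / N = k := by
        rw [← Nat.cast_sub hj, hk]
        push_cast
        rw [mul_div_cancel_left₀ _ hN']
      rw [this, eval_binomialPolynomial_natCast]
      simp
    · simp
  rw [hlhs, coeffQuasiPolynomial]
  have hext : ∀ K : ℕ, i + 1 ≤ K → N * (n + 1) ≤ K →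
      (∑ j ∈ Finset.range (i + 1), if (N : ℤ) ∣ (i : ℤ) - j then
        (A.coeff j : ℂ) * (binomialPolynomial n).eval ((((i : ℤ) - j : ℤ) : ℂ) / N) else 0) =
      ∑ j ∈ Finset.range K, if (N : ℤ) ∣ (i : ℤ) - j then
        (A.coeff j : ℂ) * (binomialPolynomial n).eval ((((i : ℤ) - j : ℤ) : ℂ) / N) else 0 := by
    intro K hK hK'
    refine Finset.sum_subset (Finset.range_mono hK) fun j hj hji => ?_
    have hji : i < j := by
      have := mt Finset.mem_range.2 hji
      omega
    split_ifs with hd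
    · by_cases hjM : j < N * (n + 1)
      · obtain ⟨k, hk⟩ := hd
        have hN'' : (0 : ℤ) < N := by exact_mod_cast hN
        have hk0 : k < 0 := by
          by_contra hk0
          have := mul_nonneg hN''.le (not_lt.1 hk0)
          omega
        obtain ⟨r, rfl⟩ : ∃ r : ℕ, k = -(r : ℤ) := ⟨k.natAbs, by omega⟩
        have hr : r ≤ n := by
          have h1 : (N : ℤ) * r < N * (n + 1) := by
            have : (j : ℤ) < N * (n + 1) := by exact_mod_cast hjM
            have h2 : (N : ℤ) * -(r : ℤ) = -(N * r) := by ring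
            omega
          have := lt_of_mul_lt_mul_left h1 hN''.le
          omega
        rw [hk]
        push_cast
        rw [mul_div_cancel_left₀ _ hN', eval_binomialPolynomial_neg (by omega) hr, mul_zero]
      · rw [Polynomial.coeff_eq_zero_of_degree_lt (hA.trans_le (by exact_mod_cast not_lt.1 hjM))]
        simp
    · rfl
  have hext' : ∀ K : ℕ, N * (n + 1) ≤ K →
      (∑ j ∈ Finset.range (N * (n + 1)), if (N : ℤ) ∣ (i : ℤ) - j then
        (A.coeff j : ℂ) * (binomialPolynomial n).eval ((((i : ℤ) - j : ℤ) : ℂ) / N) else 0) =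
      ∑ j ∈ Finset.range K, if (N : ℤ) ∣ (i : ℤ) - j then
        (A.coeff j : ℂ) * (binomialPolynomial n).eval ((((i : ℤ) - j : ℤ) : ℂ) / N) else 0 := by
    intro K hK
    refine Finset.sum_subset (Finset.range_mono hK) fun j hj hji => ?_
    have hji := not_lt.1 (mt Finset.mem_range.2 hji)
    rw [Polynomial.coeff_eq_zero_of_degree_lt (hA.trans_le (by exact_mod_cast hji))]
    simp
  rw [hext _ (le_max_left (i + 1) (N * (n + 1))) (le_max_right _ _),
    hext' _ (le_max_right (i + 1) (N * (n + 1)))]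

/-- The symmetry `j ↦ N(n+1) - 1 - j` of the coefficients of `A` matches the symmetry `x ↦ -x -
(n+1)` of the binomial polynomial. -/
theorem coeffQuasiPolynomial_neg {N : ℕ} (hN : 0 < N) {n : ℕ} {A : ℚ[X]}
    (hA : A.reflect (N * (n + 1)) = Polynomial.X * A) (i : ℤ) :
    coeffQuasiPolynomial N n A (-i) = (-1) ^ n * coeffQuasiPolynomial N n A (i - 1) := by
  have hN' : (N : ℂ) ≠ 0 := by exact_mod_cast hN.ne'
  rw [coeffQuasiPolynomial, coeffQuasiPolynomial, ← Finset.sum_range_reflect, Finset.mul_sum]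
  refine Finset.sum_congr rfl fun j hj => ?_
  have hj := Finset.mem_range.1 hj
  -- The factor `X` in `hA` shifts the index by one, hence the comparison at `j + 1`.
  have hcoeff : A.coeff (N * (n + 1) - 1 - j) = A.coeff j := by
    have := congrArg (fun p => Polynomial.coeff p (j + 1)) hA
    simp only [Polynomial.coeff_reflect, Polynomial.coeff_X_mul] at this
    rw [Polynomial.revAt_le hj] at this
    rw [← this]
    congr 1
    omega
  have hcast : ((N * (n + 1) - 1 - j : ℕ) : ℤ) = N * (n + 1) - 1 - j := by
    rw [Nat.sub_sub, Nat.cast_sub (by omega)]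
    push_cast
    ring
  have harg : -i - ((N * (n + 1) - 1 - j : ℕ) : ℤ) = -((i - 1) - j) - N * (n + 1) := by
    rw [hcast]; ring
  have hiff : (N : ℤ) ∣ -i - ((N * (n + 1) - 1 - j : ℕ) : ℤ) ↔ (N : ℤ) ∣ i - 1 - j := by
    rw [harg, dvd_sub_left (dvd_mul_right _ _), dvd_neg]
  simp only [hiff, hcoeff]
  split_ifs
  · rw [harg]
    have : ((-((i - 1) - j) - N * (n + 1) : ℤ) : ℂ) / N =
        -(((i - 1 - j : ℤ) : ℂ) / N) - (n + 1) := by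
      push_cast
      field_simp
    rw [this, eval_binomialPolynomial_reflect]
    ring
  · simp

end QuasiPolynomials

/-! ### Quasi-polynomials and reciprocity for a reciprocal series. -/

namespace IsReciprocal

variable {κ : Type*} [Fintype κ] {ι : κ → Type*} [∀ k, Fintype (ι k)]
    {G : ℚ⟦X⟧} {n : ℕ} {d : ∀ k, ι k → ℕ} {N : κ → ℚ[X]} {g g' : κ → ℚ⟦X⟧}

/-- With `K` divisible by all `d k i`, the polynomial `(1 - t^K)^n q`, `q = (1 - t^K)/(1 - t)`, is a
common denominator of degree `K(n+1) - 1`; the missing factor `1 - t` comes from `hB`. The strict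
degree bound follows, and the symmetry of `A` is the reciprocity of the cumulative series. -/
theorem exists_pow_numerator (h : IsReciprocal G n d N g g') {B : ℚ⟦X⟧}
    (hB : (1 - PowerSeries.X) * B = G) :
    ∃ K : ℕ, 0 < K ∧ ∃ A : ℚ[X], A.degree < (K * (n + 1) : ℕ) ∧
      (1 - PowerSeries.X ^ K) ^ (n + 1) * B = (A : ℚ⟦X⟧) ∧ A.reflect (K * (n + 1)) = Polynomial.X * A := by
  set K : ℕ := ∏ k, ∏ i, d k i with hK
  have hKpos : 0 < K := Finset.prod_pos fun k _ => Finset.prod_pos fun i _ => h.pos k i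
  have hdvd : ∀ e : ℕ, e ∣ K → (1 - Polynomial.X ^ e : ℚ[X]) ∣ 1 - Polynomial.X ^ K := by
    rintro e ⟨m, hm⟩
    rw [hm, pow_mul]
    simpa using sub_dvd_pow_sub_pow (1 : ℚ[X]) (Polynomial.X ^ e) m
  obtain ⟨q, hq⟩ := hdvd 1 (one_dvd _)
  rw [pow_one] at hq
  have hq0 : q ≠ 0 := by
    rintro rfl
    rw [mul_zero] at hq
    exact one_sub_X_pow_ne_zero hKpos hq
  have hdiv : ∀ k, denominator (d k) ∣ (1 - Polynomial.X ^ K) ^ n * q := by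
    intro k
    refine Dvd.dvd.mul_right ?_ _
    rw [← h.card k, ← Finset.card_univ, ← Finset.prod_const]
    refine Finset.prod_dvd_prod_of_dvd _ _ fun i _ => hdvd _ ?_
    exact (Finset.dvd_prod_of_mem (d k) (Finset.mem_univ i)).trans
      (Finset.dvd_prod_of_mem (fun k => ∏ i, d k i) (Finset.mem_univ k))
  obtain ⟨A, hdeg, hmul⟩ := h.exists_common_numerator hdiv
  have hpow : ((1 - Polynomial.X ^ K) ^ n * q) * (1 - Polynomial.X) =
      (1 - Polynomial.X ^ K : ℚ[X]) ^ (n + 1) := by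
    rw [pow_succ, mul_assoc, mul_comm q, ← hq]
  have hAB : (1 - PowerSeries.X ^ K) ^ (n + 1) * B = (A : ℚ⟦X⟧) := by
    rw [← hmul, ← hB, ← mul_assoc]
    congr 1
    have := congrArg (fun p : ℚ[X] => (p : ℚ⟦X⟧)) hpow
    simp only [Polynomial.coe_mul, Polynomial.coe_pow, Polynomial.coe_sub, Polynomial.coe_one,
      Polynomial.coe_X] at this ⊢
    exact this.symm
  have hdegA : A.degree < (K * (n + 1) : ℕ) := by
    refine hdeg.trans_lt ?_
    have hdP : ((1 - Polynomial.X ^ K : ℚ[X]) ^ (n + 1)).natDegree = K * (n + 1) := by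
      rw [Polynomial.natDegree_pow, natDegree_one_sub_X_pow, mul_comm]
    have hne : (1 - Polynomial.X ^ K : ℚ[X]) ^ n * q ≠ 0 :=
      mul_ne_zero (pow_ne_zero _ (one_sub_X_pow_ne_zero hKpos)) hq0
    have hX0 : (1 - Polynomial.X : ℚ[X]) ≠ 0 := by
      simpa using one_sub_X_pow_ne_zero one_pos
    have hX1 : (1 - Polynomial.X : ℚ[X]).natDegree = 1 := by
      simpa using natDegree_one_sub_X_pow 1
    rw [← hpow, Polynomial.natDegree_mul hne hX0, hX1] at hdP
    rw [Polynomial.degree_eq_natDegree hne]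
    exact_mod_cast (by omega)
  refine ⟨K, hKpos, A, hdegA, hAB, ?_⟩
  obtain ⟨Rb, -, hRb, -, hinv, -⟩ := h.exists_ratFunc_cumulative hB
  set a := algebraMap ℚ[X] (RatFunc ℚ)
  have hexp : IsExpansion (a A / a (denominator fun _ : Fin (n + 1) => K)) B := by
    rw [isExpansion_div_iff (denominator_ne_zero fun _ => hKpos), coe_denominator]
    simpa using hAB
  have hnat : A.natDegree ≤ ∑ _i : Fin (n + 1), K := by
    rw [Fin.sum_const, smul_eq_mul, mul_comm]
    exact Polynomial.natDegree_le_of_degree_le hdegA.le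
  rw [hRb.unique hexp, atInv_eq, atInvHom_div_denominator (fun _ => hKpos) hnat] at hinv
  rw [Fintype.card_fin, Fin.sum_const, smul_eq_mul, mul_comm (n + 1) K, mul_assoc] at hinv
  have hinv := mul_left_cancel₀ (pow_ne_zero _ (by simp)) hinv
  have ha0 : a (denominator fun _ : Fin (n + 1) => K) ≠ 0 := by
    rw [Ne, map_eq_zero_iff _ (RatFunc.algebraMap_injective ℚ)]
    exact denominator_ne_zero fun _ => hKpos
  rw [← mul_div_assoc, div_left_inj' ha0, ← RatFunc.algebraMap_X, ← map_mul] at hinv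
  exact RatFunc.algebraMap_injective ℚ hinv

/-- The growth sequences of a reciprocal series are quasi-polynomials which satisfy
reciprocity laws. -/
theorem quasiPolynomial (h : IsReciprocal G n d N g g') {b s : ℕ → ℕ}
    (hG : G = PowerSeries.mk fun i => (s i : ℚ))
    (hb : (1 - PowerSeries.X) * PowerSeries.mk (fun i => (b i : ℚ)) = G) :
    IsQuasiPolynomialOn b 0 ∧
    (∀ fb, IsQuasiPolynomialOf fb b → ∀ i : ℤ, fb (-i) = (-1) ^ n * fb (i - 1)) ∧
    IsQuasiPolynomialOn s 1 ∧
    (∀ fs, IsQuasiPolynomialOf fs s → ∀ i : ℤ, i ≠ 0 → fs (-i) = (-1) ^ (n + 1) * fs i) := by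
  obtain ⟨K, hK, A, hA, hAB, hrefl⟩ := h.exists_pow_numerator hb
  set f := coeffQuasiPolynomial K n A with hf
  have hfq : IsQuasiPolynomial f := isQuasiPolynomial_coeffQuasiPolynomial hK n A
  have hfb : ∀ i : ℕ, (b i : ℂ) = f i := by
    intro i
    rw [hf, ← coeff_eq_coeffQuasiPolynomial hK hA hAB, PowerSeries.coeff_mk]
    simp
  have hfneg : ∀ i, f (-i) = (-1) ^ n * f (i - 1) := coeffQuasiPolynomial_neg hK hrefl
  -- The range starts at 1 because `f (-1) = (-1)^n b_0` need not vanish, whereas `s_0 = b_0`.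
  have hs : ∀ i, 1 ≤ i → (s i : ℂ) = (f - fun i => f (i - 1)) i := by
    intro i hi
    obtain ⟨i, rfl⟩ : ∃ j, i = j + 1 := ⟨i - 1, by omega⟩
    have h1 := congrArg (PowerSeries.coeff (i + 1)) (hb.trans hG)
    rw [sub_mul, one_mul, map_sub, PowerSeries.coeff_succ_X_mul] at h1
    simp only [PowerSeries.coeff_mk] at h1
    have h2 : (s (i + 1) : ℂ) = b (i + 1) - b i := by exact_mod_cast h1.symm
    rw [h2, hfb, hfb, Pi.sub_apply]
    push_cast
    simp
  have hsq : IsQuasiPolynomial (f - fun i => f (i - 1)) := hfq.sub hfq.shift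
  refine ⟨⟨f, hfq, fun i _ => hfb i⟩, ?_, ⟨_, hsq, hs⟩, ?_⟩
  · intro fb hfb' i
    rw [hfb'.unique ⟨hfq, 0, fun i _ => hfb i⟩, hfneg]
  · intro fs hfs i _
    rw [hfs.unique ⟨hsq, 0, fun i hi => hs i hi⟩]
    simp only [Pi.sub_apply]
    rw [hfneg, show -i - 1 = -(i + 1) by ring, hfneg, add_sub_cancel_right, pow_succ]
    ring

end IsReciprocal

/-! ### The growth series of a well-arranged periodic graph -/

section Growth

variable {L V E : Type*} [AddCommGroup L] [AddAction L V] [AddAction L E]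

namespace WGraph

variable {V E : Type*} {Γ : WGraph V E}

theorem StronglyConnected.sphereSeries_eq (h : Γ.StronglyConnected) (x₀ : V) :
    Γ.sphereSeries x₀ = genFun (Γ.natDist x₀) Set.univ := by
  ext i
  simp [sphereSeries, genFun, sphereCard, h.dist_eq]

theorem StronglyConnected.one_sub_X_mul_ballSeries (h : Γ.StronglyConnected) (x₀ : V)
    (hfin : ∀ i, {y | Γ.natDist x₀ y ≤ i}.Finite) :
    (1 - PowerSeries.X) * Γ.ballSeries x₀ = Γ.sphereSeries x₀ := by
  ext i
  rw [sub_mul, one_mul, map_sub]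
  cases i with
  | zero => simp [ballSeries, sphereSeries, ballCard, sphereCard, h.dist_eq]
  | succ i =>
    rw [PowerSeries.coeff_succ_X_mul, sub_eq_iff_eq_add]
    simp only [ballSeries, sphereSeries, PowerSeries.coeff_mk, ballCard, sphereCard, h.dist_eq,
      Nat.cast_inj, Nat.cast_le]
    norm_cast
    have hfib : {y | Γ.natDist x₀ y = i + 1}.Finite :=
      (hfin (i + 1)).subset fun y hy => le_of_eq hy
    rw [← Set.ncard_union_eq _ hfib (hfin i)]
    · congr 1
      ext y
      simp only [Set.mem_ofPred_eq, Set.mem_union]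
      omega
    · rw [Set.disjoint_left]
      intro y hy hy'
      simp only [Set.mem_ofPred_eq] at hy hy'
      omega

end WGraph

variable {Γ : PeriodicGraph L V E} {Φ : V → RealSpan L} {x₀ : V} {d : RealSpan L → ℕ}
  {T : Set (RealSpan L) → Finset (Finset (RealSpan L))}

/-- The points which span the growth polytope. -/
def generators (Γ : PeriodicGraph L V E) : Finset (RealSpan L) :=
  (Γ.finite_normalizedCycles.union (Set.finite_singleton 0)).toFinset

theorem coe_generators (Γ : PeriodicGraph L V E) :
    (generators Γ : Set (RealSpan L)) = Γ.normalizedCycles ∪ {0} := by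
  simp [generators]

theorem convexHull_generators (Γ : PeriodicGraph L V E) :
    convexHull ℝ (generators Γ : Set (RealSpan L)) = Γ.growthPolytope := by
  rw [coe_generators, PeriodicGraph.growthPolytope]

theorem IsArrangement.facetTriangulation (h : IsArrangement Γ Φ x₀ d T)
    (hconn : Γ.StronglyConnected) : FacetTriangulation (generators Γ) T where
  zero_mem := by simp [generators]
  inCone := PeriodicGraph.inCone_normalizedCycles hconn x₀ (by
    rw [coe_generators]; exact Set.subset_union_left)
  triangulation := by
    rw [convexHull_generators]; exact h.triangulation
  vertices := by
    rw [convexHull_generators]; exact h.vertices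

/-- The coordinates of a lattice vector with respect to a basis. -/
def latticeCoord {ι : Type*} [Finite ι] (b : Module.Basis ι ℝ (RealSpan L)) : L →+ (ι → ℝ) :=
  b.equivFun.toLinearMap.toAddMonoidHom.comp (toRealHom L)

theorem latticeCoord_apply {ι : Type*} [Finite ι] (b : Module.Basis ι ℝ (RealSpan L)) (u : L)
    (i : ι) : latticeCoord b u i = b.repr (toReal u) i := rfl

-- The link between the graph and the abstract cones: the facet normal gives the lower bound, and
-- condition 3 of the arrangement gives the box identity.
open FacetTriangulation in
theorem IsArrangement.exists_isGeodesicCone [Module.Finite ℤ L] (h : IsArrangement Γ Φ x₀ d T)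
    (hconn : Γ.StronglyConnected) (hundir : Γ.Undirected) (hΦ : Γ.IsRealization Φ)
    {Δ : Finset (RealSpan L)} (hΔ : Δ ∈ simplices (generators Γ) T) :
    ∃ w : Δ → L, IsGeodesicCone Γ.natDist x₀
      (fun y v => ((h.facetTriangulation hconn).basis hΔ).repr (Φ y - Φ x₀) v)
      (latticeCoord ((h.facetTriangulation hconn).basis hΔ)) w fun v => d v := by
  classical
  set hF := h.facetTriangulation hconn
  set b := hF.basis hΔ with hb
  have hbv : ∀ v, b v = v := fun v => hF.basis_apply hΔ v
  have hext : ∀ v : Δ, (v : RealSpan L) ∈ Γ.growthPolytope.extremePoints ℝ := fun v => by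
    rw [← convexHull_generators]; exact hF.subset_extremePoints hΔ v.2
  choose w hw using fun v : Δ => h.integral v (hext v)
  obtain ⟨l, hl, hlΔ⟩ := hF.exists_normal hΔ
  refine ⟨w, WGraph.natDist_self _, hconn.natDist_triangle, hconn.natDist_comm hundir,
    PeriodicGraph.natDist_vadd hconn, fun v => h.pos v (hext v), ?_, ?_, ?_, ?_, ?_⟩
  · ext v; simp
  · intro u y
    ext v
    rw [Pi.add_apply, latticeCoord_apply, hΦ, add_sub_assoc, map_add, Finsupp.add_apply]
  · intro i j
    rw [latticeCoord_apply, hw, ← hbv i, map_smul, b.repr_self, Finsupp.smul_apply,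
      Finsupp.single_apply, smul_eq_mul, mul_ite, mul_one, mul_zero, hbv]
    simp only [eq_comm]
  · intro k
    have h1 := PeriodicGraph.map_toReal_le_natDist hconn l (fun a ha => hl a (by
      have : a ∈ (generators Γ : Set (RealSpan L)) := by
        rw [coe_generators]; exact Or.inl ha
      exact this)) x₀ (∑ i, k i • w i)
    have h2 : l (toReal (∑ i, k i • w i)) = ((∑ i, k i * d i : ℕ) : ℝ) := by
      rw [toReal_sum, map_sum]
      push_cast
      refine Finset.sum_congr rfl fun i _ => ?_
      rw [toReal_nsmul, hw, map_smul, map_smul, hlΔ i i.2, smul_eq_mul, smul_eq_mul, mul_one]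
    rw [h2] at h1
    exact_mod_cast h1
  -- Take `V' = s`, and as coefficients the coordinates of `y`, extended by zero outside `Δ`.
  · intro s y hy hys
    obtain ⟨σ, hσ, hT⟩ := hΔ
    rw [convexHull_generators] at hσ
    have hbox := h.dist_add σ hσ Δ hT (s.map (Function.Embedding.subtype _)) (by
      intro v hv
      obtain ⟨v', -, rfl⟩ := Finset.mem_map.1 hv
      exact v'.2) (∑ v ∈ s, w v) (by
      rw [toReal_sum]
      simp [hw]) y ⟨fun x => if hx : x ∈ Δ then b.repr (Φ y - Φ x₀) ⟨x, hx⟩ else 0, ?_, ?_⟩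
    · rw [hconn.dist_eq, hconn.dist_eq] at hbox
      have : Γ.natDist x₀ y + Γ.natDist y ((∑ v ∈ s, w v) +ᵥ x₀) =
          ∑ v ∈ s.map (Function.Embedding.subtype _), d v := by exact_mod_cast hbox
      rw [this]
      simp
    · intro v hv
      obtain ⟨v', -, rfl⟩ := Finset.mem_map.1 hv
      simpa using hy v'
    · rw [Finset.sum_map]
      conv_lhs => rw [← b.sum_repr (Φ y - Φ x₀)]
      simp only [hbv]
      refine Eq.trans (Finset.sum_subset (Finset.subset_univ s) fun v _ hv => ?_).symm
        (Finset.sum_congr rfl fun v _ => ?_)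
      · rw [hys v hv, zero_smul]
      · simp

-- The two decompositions are the half-open cones for `ξ` and their negatives with complementary
-- walls.
open FacetTriangulation in
theorem IsArrangement.exists_isReciprocal [Module.Free ℤ L] [Module.Finite ℤ L]
    (h : IsArrangement Γ Φ x₀ d T)
    (hn : 0 < Module.finrank ℤ L) (hconn : Γ.StronglyConnected) (hundir : Γ.Undirected)
    (hΦ : Γ.IsRealization Φ) [Fintype (simplices (generators Γ) T)] :
    ∃ N g g', IsReciprocal (Γ.sphereSeries x₀) (Module.finrank ℤ L)
      (fun (Δ : simplices (generators Γ) T) (v : Δ.1) => d v) N g g' := by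
  classical
  set hF := h.facetTriangulation hconn
  have hrank : Module.finrank ℝ (RealSpan L) = Module.finrank ℤ L := Module.finrank_baseChange
  have hball := PeriodicGraph.finite_ball hconn x₀
  have hfib : ∀ m, {y | Γ.natDist x₀ y = m}.Finite := fun m =>
    (hball m).subset fun y hy => le_of_eq hy
  obtain ⟨ξ, hξ⟩ := exists_generic (generators Γ)
  choose w hcone using fun Δ : simplices (generators Γ) T =>
    h.exists_isGeodesicCone hconn hundir hΦ Δ.2
  choose N hdeg hN hN' using fun Δ : simplices (generators Γ) T =>
    (hcone Δ).exists_numerator hball fun v => 0 < (hF.basis Δ.2).repr ξ v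
  refine ⟨N, fun Δ => genFun (Γ.natDist x₀) (halfOpenSet
      (fun y v => (hF.basis Δ.2).repr (Φ y - Φ x₀) v) fun v => 0 < (hF.basis Δ.2).repr ξ v),
    fun Δ => genFun (Γ.natDist x₀) (halfOpenSet
      (-fun y v => (hF.basis Δ.2).repr (Φ y - Φ x₀) v) fun v => ¬ 0 < (hF.basis Δ.2).repr ξ v),
    ?_, ?_, hdeg, ?_, ?_, fun Δ => ?_, fun Δ => ?_⟩
  · exact fun Δ => (hcone Δ).pos
  · intro Δ
    rw [Fintype.card_coe, hF.card_eq Δ.2, hrank]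
  · rw [hconn.sphereSeries_eq]
    refine genFun_univ_eq_sum hfib _ fun y => ?_
    exact hF.existsUnique_halfOpen (hrank ▸ hn) hξ (Φ y - Φ x₀)
  · rw [hconn.sphereSeries_eq]
    refine genFun_univ_eq_sum hfib _ fun y => ?_
    -- Genericity excludes zero coordinates of `ξ`, so the complementary walls are those selected by
    -- `-ξ`, and the partition theorem applies to the negated point.
    have hiff : ∀ Δ : simplices (generators Γ) T, y ∈ halfOpenSet
        (-fun y v => (hF.basis Δ.2).repr (Φ y - Φ x₀) v) (fun v => ¬ 0 < (hF.basis Δ.2).repr ξ v) ↔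
        hF.HalfOpen (-ξ) Δ.2 (-(Φ y - Φ x₀)) := by
      intro Δ
      refine forall_congr' fun v => ?_
      have hne := hF.repr_ne_zero Δ.2 hξ v
      have hlt : ¬ 0 < (hF.basis Δ.2).repr ξ v ↔ 0 < -(hF.basis Δ.2).repr ξ v := by
        rw [neg_pos, not_lt, hne.le_iff_lt]
      simp only [map_neg, Finsupp.neg_apply, ← hlt]
      rfl
    simp only [hiff]
    exact hF.existsUnique_halfOpen (hrank ▸ hn) hξ.neg (-(Φ y - Φ x₀))
  · rw [coe_denominator]; exact hN Δ
  · rw [coe_denominator]; exact hN' Δ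

end Growth

end PeriodicGrowth

end


theorem theorem5p8 {L V E : Type*} [AddCommGroup L] [Module.Free ℤ L] [Module.Finite ℤ L]
    [AddAction L V] [AddAction L E] (n : ℕ) (hn : 0 < n) (hL : Module.finrank ℤ L = n)
    (Γ : PeriodicGraph L V E) (hconn : Γ.StronglyConnected) (hundir : Γ.Undirected)
    (Φ : V → RealSpan L) (hΦ : Γ.IsRealization Φ) (x₀ : V) (hWA : WellArranged Γ Φ x₀) :
    -- the cumulative growth sequence is a quasi-polynomial on `i ≥ 0`
    IsQuasiPolynomialOn (Γ.ballCard x₀) 0 ∧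
    -- the form of the growth series, for all `d_v` and `T_σ` as in the definition
    (∀ d T, IsArrangement Γ Φ x₀ d T →
      ∃ Q₁ Q₂ : Polynomial ℚ, IsLCM (simplexPolynomials Γ d T) Q₂ ∧ Q₁.degree ≤ Q₂.degree ∧
        IsExpansion (algebraMap (Polynomial ℚ) (RatFunc ℚ) Q₁ /
          algebraMap (Polynomial ℚ) (RatFunc ℚ) Q₂) (Γ.sphereSeries x₀)) ∧
    -- the reciprocity laws for the generating functions
    (∃ Gb Gs : RatFunc ℚ,
      IsExpansion Gb (Γ.ballSeries x₀) ∧ IsExpansion Gs (Γ.sphereSeries x₀) ∧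
      atInv Gb = (-1) ^ (n + 1) * RatFunc.X * Gb ∧ atInv Gs = (-1) ^ n * Gs) ∧
    -- the reciprocity laws for the corresponding quasi-polynomials
    (∀ fb, IsQuasiPolynomialOf fb (Γ.ballCard x₀) →
      ∀ i : ℤ, fb (-i) = (-1) ^ n * fb (i - 1)) ∧
    IsQuasiPolynomialOn (Γ.sphereCard x₀) 1 ∧
    (∀ fs, IsQuasiPolynomialOf fs (Γ.sphereCard x₀) →
      ∀ i : ℤ, i ≠ 0 → fs (-i) = (-1) ^ (n + 1) * fs i) := by

  subst hL
  obtain ⟨d, T, hA⟩ := hWA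
  have key : ∀ d T, IsArrangement Γ Φ x₀ d T → ∃ Q₁ Q₂ : Polynomial ℚ,
      IsLCM (simplexPolynomials Γ d T) Q₂ ∧ Q₁.degree ≤ Q₂.degree ∧
        IsExpansion (algebraMap (Polynomial ℚ) (RatFunc ℚ) Q₁ /
          algebraMap (Polynomial ℚ) (RatFunc ℚ) Q₂) (Γ.sphereSeries x₀) := by
    intro d T hA
    have := (hA.facetTriangulation hconn).finite_simplices.fintype
    obtain ⟨N, g, g', hrec⟩ := hA.exists_isReciprocal hn hconn hundir hΦ
    refine hrec.exists_lcm ?_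
    ext f
    simp only [simplexPolynomials, Set.mem_ofPred_eq, Set.mem_range, Subtype.exists]
    constructor
    · rintro ⟨σ, hσ, Δ, hΔ, rfl⟩
      refine ⟨Δ, ⟨σ, by rwa [convexHull_generators], hΔ⟩, ?_⟩
      exact Finset.prod_coe_sort Δ fun v => (1 - (Polynomial.X : Polynomial ℚ) ^ d v)
    · rintro ⟨Δ, ⟨σ, hσ, hΔ⟩, rfl⟩
      refine ⟨σ, by rwa [← convexHull_generators], Δ, hΔ, ?_⟩
      exact Finset.prod_coe_sort Δ fun v => (1 - (Polynomial.X : Polynomial ℚ) ^ d v)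
  -- The remaining claims do not mention the arrangement, so any single one suffices.
  have := (hA.facetTriangulation hconn).finite_simplices.fintype
  obtain ⟨N, g, g', hrec⟩ := hA.exists_isReciprocal hn hconn hundir hΦ
  have hb := hconn.one_sub_X_mul_ballSeries x₀ (PeriodicGraph.finite_ball hconn x₀)
  obtain ⟨h1, h2, h3, h4⟩ := hrec.quasiPolynomial (b := Γ.ballCard x₀) (s := Γ.sphereCard x₀) rfl hb
  exact ⟨h1, key, hrec.exists_ratFunc_cumulative hb, h2, h3, h4⟩
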